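/- Let $K\ge 2$ and let $\mathbb T$ be the infinite rooted tree in which every vertex has $K+1$ edges, except for the root $0$, which has exactly one; let $\mathcal E$ be its edge set, let $0\in\mathcal E$ also denote the edge at the root, and let $\mathcal N_e^+$ be the set of the $K$ edges forward to $e$. Let $L>0$, $\lambda\in\mathbb R$, and let $(\omega_e)_{e\in\mathcal E}$ be independent, identically distributed, bounded real random variables. Give the edge $e$ the length $L_e=L_e(\lambda,\omega)=L\,e^{\lambda\omega_e}$, i.e. identify it with $[0,L_e]$, the coordinate increasing away from the root. For $z\in\mathbb C^+=\{\operatorname{Im}z>0\}$ let $\psi^+=(\psi^+_e)_{e\in\mathcal E}$, $\psi_e^+\in H^2[0,L_e]$, be the (almost surely unique) solution of $$-(\psi^+_e)''=z\,\psi^+_e \ \text{ on } [0,L_e],\qquad \psi_f^+(0)=\psi_e^+(L_e)\ (f\in\mathcal N_e^+),\qquad (\psi_e^+)'(L_e)=\sum_{f\in\mathcal N_e^+}(\psi_f^+)'(0),$$ for all $e\in\mathcal E$, with $\sum_e\int_0^{L_e}|\psi^+_e|^2<\infty$, normalized by $\psi^+_0(0)=1$ and with no boundary condition at the root. Set $R^+_0(0;z)=(\psi_0^+)'(0)/\psi_0^+(0)$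 and, for any $f\in\mathcal N_0^+$, $$\gamma_\lambda(z)=-\mathbb E\Big[\log\Big(\sqrt K\,\frac{|\psi_f^+(0)|}{|\psi_0^+(0)|}\Big)\Big].$$ For a positive random variable $X$ and $a\in(0,1/2]$ let the relative $a$-width be $\delta(X,a)=1-\xi_-(X,a)/\xi_+(X,a)$ with $\xi_-(X,a)=\sup\{\xi:\mathbb P(X<\xi)\le a\}$ and $\xi_+(X,a)=\inf\{\xi:\mathbb P(X>\xi)\le a\}$. Theorem. For all $\lambda\in\mathbb R$ and $z\in\mathbb C^+$ the logarithm in the definition of $\gamma_\lambda(z)$ is integrable, and for all $a\in(0,1/2]$ $$\delta\big(\operatorname{Im}R^+_0(0;z),a\big)^2\le\frac{8}{a^2}\,\gamma_\lambda(z),$$ $$\delta\Big(\Big|\cos(\sqrt z\,L_0)+\frac{\sin(\sqrt z\,L_0)}{\sqrt z}\,R^+_0(0;z)\Big|^2,a\Big)^2\le 512\,\frac{(K+1)^2}{a^2}\,\gamma_\lambda(z),$$ where, for $a=1/2$, each inequality is asserted only if the relative width in it is nonnegative (which is automatic for $a<1/2$). -/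

import Mathlib

open MeasureTheory ProbabilityTheory

noncomputable section

namespace QuantumTree

/-- The edges of the rooted tree with branching number `K`, coded as words: the empty word is the
single edge at the root, and the `K` edges forward to the edge `e` are `j :: e`, `j : Fin K`. -/
abbrev Edge (K : ℕ) : Type := List (Fin K)

/-- `f` belongs to the Sobolev space `H²[0, ℓ]`, with first derivative `f'` (taken continuous, up to
the end points) and weak second derivative `f''`. -/
structure IsH2 (ℓ : ℝ) (f f' f'' : ℝ → ℂ) : Prop where
  memLp : MemLp f'' 2 (volume.restrict (Set.Icc 0 ℓ))
  eq_integral' : ∀ x ∈ Set.Icc 0 ℓ, f' x = f' 0 + ∫ t in (0 : ℝ)..x, f'' t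
  eq_integral : ∀ x ∈ Set.Icc 0 ℓ, f x = f 0 + ∫ t in (0 : ℝ)..x, f' t

/-- `ψ` (with edge-wise derivative `ψ'`) is a square-integrable solution of `-ψ'' = z ψ` on the
metric tree whose edge `e` is the interval `[0, len e]`. It satisfies the Kirchhoff conditions at
all internal vertices; no condition is imposed at the root, the open vertex. -/
structure IsL2Solution {K : ℕ} (len : Edge K → ℝ) (z : ℂ) (ψ ψ' : Edge K → ℝ → ℂ) : Prop where
  eqn : ∀ e, ∃ ψ'' : ℝ → ℂ, IsH2 (len e) (ψ e) (ψ' e) ψ'' ∧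
    ∀ᵐ x ∂(volume.restrict (Set.Icc 0 (len e))), -ψ'' x = z * ψ e x
  continuous_vertex : ∀ e j, ψ (j :: e) 0 = ψ e (len e)
  kirchhoff : ∀ e, ψ' e (len e) = ∑ j : Fin K, ψ' (j :: e) 0
  square_integrable : ∑' e, ∫⁻ x in Set.Icc 0 (len e), ‖ψ e x‖ₑ ^ 2 < ⊤

/-- The square-integrable solution `ψ⁺(·; z | 0)` normalized to be `1` at the root, together with
its edge-wise derivative. (For edge lengths bounded away from `0` and `∞` and `Im z > 0` it exists,
and the values on the edges are unique.) -/
def psiPair {K : ℕ} (len : Edge K → ℝ) (z : ℂ) : (Edge K → ℝ → ℂ) × (Edge K → ℝ → ℂ) :=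
  Classical.epsilon fun p => IsL2Solution len z p.1 p.2 ∧ p.1 [] 0 = 1

/-- `ψ⁺_e(l; z | 0)`. -/
def psiPlus {K : ℕ} (len : Edge K → ℝ) (z : ℂ) (e : Edge K) (l : ℝ) : ℂ :=
  (psiPair len z).1 e l

/-- The derivative of `ψ⁺_e(·; z | 0)` at `l`, in the direction away from the root. -/
def psiPlusDeriv {K : ℕ} (len : Edge K → ℝ) (z : ℂ) (e : Edge K) (l : ℝ) : ℂ :=
  (psiPair len z).2 e l

/-- The Weyl-Titchmarsh function `R⁺_e(l; z)`. -/
def RPlus {K : ℕ} (len : Edge K → ℝ) (z : ℂ) (e : Edge K) (l : ℝ) : ℂ :=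
  psiPlusDeriv len z e l / psiPlus len z e l

/-- The edge lengths `L exp (lam * w e)` of the deformed tree. -/
def deformedLength {K : ℕ} (L lam : ℝ) (w : Edge K → ℝ) (e : Edge K) : ℝ :=
  L * Real.exp (lam * w e)

variable {Ω : Type*} [MeasurableSpace Ω]

/-- `ξ₋(X, a)`. -/
def xiMinus (P : Measure Ω) (X : Ω → ℝ) (a : ℝ) : ℝ :=
  sSup {ξ : ℝ | P.real {x | X x < ξ} ≤ a}

/-- `ξ₊(X, a)`. -/
def xiPlus (P : Measure Ω) (X : Ω → ℝ) (a : ℝ) : ℝ :=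
  sInf {ξ : ℝ | P.real {x | ξ < X x} ≤ a}

/-- The relative `a`-width `δ(X, a)` of the distribution of `X`. -/
def relWidth (P : Measure Ω) (X : Ω → ℝ) (a : ℝ) : ℝ :=
  1 - xiMinus P X a / xiPlus P X a

/-- The random variable `log (√K |ψ⁺_f(0; z | 0)| / |ψ⁺_0(0; z | 0)|)`, where `f` is the `j`-th edge
forward to the root edge. -/
def logRatio {K : ℕ} (w : Edge K → Ω → ℝ) (L lam : ℝ) (z : ℂ) (j : Fin K) (x : Ω) : ℝ :=
  Real.log (√(K : ℝ) *
    (‖psiPlus (deformedLength L lam fun e => w e x) z [j] 0‖ /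
      ‖psiPlus (deformedLength L lam fun e => w e x) z [] 0‖))

/-- The Lyapunov exponent `γ_lam(z)`. -/
def lyapunov {K : ℕ} (P : Measure Ω) (w : Edge K → Ω → ℝ) (L lam : ℝ) (z : ℂ) (j : Fin K) : ℝ :=
  -∫ x, logRatio w L lam z j x ∂P

/-- The random variable `Im R⁺_0(0; z)`. -/
def imR {K : ℕ} (w : Edge K → Ω → ℝ) (L lam : ℝ) (z : ℂ) (x : Ω) : ℝ :=
  (RPlus (deformedLength L lam fun e => w e x) z [] 0).im

/-- The random variable `|cos (√z L_0) + sin (√z L_0) R⁺_0(0; z) / √z|²`; the principal branch of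
the square root is used (the value does not depend on the branch). -/
def modSq {K : ℕ} (w : Edge K → Ω → ℝ) (L lam : ℝ) (z : ℂ) (x : Ω) : ℝ :=
  let len := deformedLength L lam fun e => w e x
  let s : ℂ := z ^ (1 / 2 : ℂ)
  ‖Complex.cos (s * len []) + Complex.sin (s * len []) / s * RPlus len z [] 0‖ ^ 2

end QuantumTree

end

/-! Let `X` be `Im R⁺` at the root, `Y j` the same quantity at the start of the `j`-th forward edge,
and `Q` the squared modulus of `ψ⁺_f(0) / ψ⁺_0(0)`. The current `Im (ψ̄ ψ')` is conserved at
vertices and decreases along edges (`current_identity`), so `Q * ∑ Y j ≤ X`. The `Y j` come from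
disjoint subtrees and are independent copies of `X`. Taking logarithms and expectations gives
`two_mul_exponent`: `2γ` is the mean logarithmic loss of current plus the gap in Jensen's inequality
for the logarithm of the mean of the `Y j`. Both terms are nonnegative.

If `X` has relative width `δ`, two independent copies lie on opposite sides of the quantiles with
probability at least `2a²`. There strict concavity of the logarithm costs `δ²/8`, so the gap is at
least `a²δ²/4` (`pair_jensen_gap`, `jensen_gap`). This is the first bound. For the second, `Q`
equals `X / ∑ Y j` times the exponential of minus the loss; a union bound over quantile events, with
Markov's inequality for the loss, controls the quantiles of `Q` (`relWidth_Q_le`).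

The analytic part shows that `ψ⁺` is well defined and measurable in the randomness. Existence comes
from solving the Riccati equations on the tree by compactness (`exists_riccati`), uniqueness from
the summed current identity (`IsCauchyData.eq_zero`), and measurability from continuity in the edge
lengths (`continuous_RPlus`). -/

noncomputable section

namespace QuantumTree

/-! ### Explicit solutions on one edge -/

section

/-- The solution `cos (√z x)` of `-u'' = z u`. -/
def cosSol (z : ℂ) (x : ℝ) : ℂ := Complex.cos (z ^ (1 / 2 : ℂ) * x)

/-- The solution `sin (√z x) / √z` of `-u'' = z u`. -/
def sinSol (z : ℂ) (x : ℝ) : ℂ := Complex.sin (z ^ (1 / 2 : ℂ) * x) / z ^ (1 / 2 : ℂ)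

/-- The solution of `-u'' = z u` with `u 0 = a` and `u' 0 = b`. -/
def sol (z a b : ℂ) (x : ℝ) : ℂ := a * cosSol z x + b * sinSol z x

/-- The derivative of `sol z a b`. -/
def dsol (z a b : ℂ) (x : ℝ) : ℂ := b * cosSol z x - z * a * sinSol z x

variable {z : ℂ}

lemma sqrt_mul_self (z : ℂ) : z ^ (1 / 2 : ℂ) * z ^ (1 / 2 : ℂ) = z := by
  have := Complex.cpow_nat_inv_pow z (n := 2) two_ne_zero
  rw [pow_two] at this
  simpa using this

lemma sqrt_ne_zero (hz : 0 < z.im) : z ^ (1 / 2 : ℂ) ≠ 0 := by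
  intro h
  have := sqrt_mul_self z
  rw [h, zero_mul] at this
  rw [← this] at hz
  simp at hz

@[simp] lemma cosSol_zero : cosSol z 0 = 1 := by simp [cosSol]

@[simp] lemma sinSol_zero : sinSol z 0 = 0 := by simp [sinSol]

@[simp] lemma sol_zero (a b : ℂ) : sol z a b 0 = a := by simp [sol]

@[simp] lemma dsol_zero (a b : ℂ) : dsol z a b 0 = b := by simp [dsol]

lemma cosSol_sq_add (hz : 0 < z.im) (x : ℝ) : cosSol z x ^ 2 + z * sinSol z x ^ 2 = 1 := by
  have h := sqrt_ne_zero hz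
  have h2 := sqrt_mul_self z
  rw [cosSol, sinSol]
  generalize z ^ (1 / 2 : ℂ) = s at *
  rw [← h2]
  field_simp
  exact Complex.cos_sq_add_sin_sq _

lemma hasDerivAt_cosSol (hz : 0 < z.im) (x : ℝ) :
    HasDerivAt (cosSol z) (-z * sinSol z x) x := by
  have h := sqrt_ne_zero hz
  have h2 := sqrt_mul_self z
  unfold cosSol sinSol
  generalize z ^ (1 / 2 : ℂ) = s at *
  have h3 : HasDerivAt (fun y : ℝ => s * (y : ℂ)) s x := by
    simpa using (Complex.ofRealCLM.hasDerivAt (x := x)).const_mul s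
  have h4 := (Complex.hasDerivAt_cos (s * x)).comp x h3
  refine h4.congr_deriv ?_
  rw [← h2]
  field_simp

lemma hasDerivAt_sinSol (hz : 0 < z.im) (x : ℝ) : HasDerivAt (sinSol z) (cosSol z x) x := by
  have h := sqrt_ne_zero hz
  unfold cosSol sinSol
  generalize z ^ (1 / 2 : ℂ) = s at *
  have h3 : HasDerivAt (fun y : ℝ => s * (y : ℂ)) s x := by
    simpa using (Complex.ofRealCLM.hasDerivAt (x := x)).const_mul s
  have h4 := ((Complex.hasDerivAt_sin (s * x)).comp x h3).div_const s
  refine h4.congr_deriv ?_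
  field_simp

lemma hasDerivAt_sol (hz : 0 < z.im) (a b : ℂ) (x : ℝ) :
    HasDerivAt (sol z a b) (dsol z a b x) x := by
  refine (((hasDerivAt_cosSol hz x).const_mul a).add
    ((hasDerivAt_sinSol hz x).const_mul b)).congr_deriv ?_
  rw [dsol]; ring

lemma hasDerivAt_dsol (hz : 0 < z.im) (a b : ℂ) (x : ℝ) :
    HasDerivAt (dsol z a b) (-(z * sol z a b x)) x := by
  refine (((hasDerivAt_cosSol hz x).const_mul b).sub
    ((hasDerivAt_sinSol hz x).const_mul (z * a))).congr_deriv ?_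
  rw [sol]; ring

@[fun_prop] lemma continuous_cosSol : Continuous (cosSol z) := by unfold cosSol; fun_prop

@[fun_prop] lemma continuous_sinSol : Continuous (sinSol z) := by unfold sinSol; fun_prop

@[fun_prop] lemma continuous_sol (a b : ℂ) : Continuous (sol z a b) := by unfold sol; fun_prop

@[fun_prop] lemma continuous_dsol (a b : ℂ) : Continuous (dsol z a b) := by unfold dsol; fun_prop

lemma sinSol_ne_zero (hz : 0 < z.im) {x : ℝ} (hx : 0 < x) : sinSol z x ≠ 0 := by
  have h := sqrt_ne_zero hz
  have h2 := sqrt_mul_self z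
  unfold sinSol
  generalize z ^ (1 / 2 : ℂ) = s at *
  refine div_ne_zero (fun h0 => ?_) h
  obtain ⟨k, hk⟩ := Complex.sin_eq_zero_iff.1 h0
  have hs : s = ((k * Real.pi / x : ℝ) : ℂ) := by
    have : (x : ℂ) ≠ 0 := by exact_mod_cast hx.ne'
    push_cast
    rw [eq_div_iff this, hk]
  rw [← h2, hs, ← Complex.ofReal_mul, Complex.ofReal_im] at hz
  exact lt_irrefl _ hz

end

/-! ### Current, coercivity and weak solutions on one edge -/

section

variable {z : ℂ}

/-- The current `Im (ū u')` decays along an edge at the rate `Im z |u|²`. -/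
lemma current_identity (hz : 0 < z.im) (a b : ℂ) (l : ℝ) :
    (star a * b).im - (star (sol z a b l) * dsol z a b l).im =
      z.im * ∫ x in (0 : ℝ)..l, ‖sol z a b x‖ ^ 2 := by
  have hd (x : ℝ) : HasDerivAt (fun x => (star (sol z a b x) * dsol z a b x).im)
      (-(z.im * ‖sol z a b x‖ ^ 2)) x := by
    have h := (hasDerivAt_sol hz a b x).star.mul (hasDerivAt_dsol hz a b x)
    refine (Complex.imCLM.hasFDerivAt.comp_hasDerivAt x h).congr_deriv ?_
    rw [← Complex.normSq_eq_norm_sq, Complex.normSq_apply]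
    simp only [Complex.imCLM_apply, Complex.star_def, Complex.add_im, Complex.mul_im,
      Complex.conj_re, Complex.conj_im, Complex.neg_im, Complex.neg_re, Complex.mul_re]
    ring
  have h := intervalIntegral.integral_eq_sub_of_hasDerivAt (fun x _ => hd x)
    (Continuous.intervalIntegrable (by fun_prop) 0 l)
  rw [intervalIntegral.integral_neg, intervalIntegral.integral_const_mul] at h
  simp only [sol_zero, dsol_zero] at h
  linarith

/-- Coercivity of the `L²[0, l]` norm of a solution in terms of its Cauchy data. -/
lemma exists_coercive (hz : 0 < z.im) {l : ℝ} (hl : 0 < l) :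
    ∃ κ > 0, ∀ a b : ℂ, κ * (‖a‖ ^ 2 + ‖b‖ ^ 2) ≤ ∫ x in (0 : ℝ)..l, ‖sol z a b x‖ ^ 2 := by
  set N : ℂ × ℂ → ℝ := fun p => ∫ x in (0 : ℝ)..l, ‖sol z p.1 p.2 x‖ ^ 2 with hN
  have hcont : Continuous N := by
    apply intervalIntegral.continuous_parametric_intervalIntegral_of_continuous'
    simp only [Function.uncurry_def, sol]
    fun_prop
  have hpos (p : ℂ × ℂ) (hp : p ≠ 0) : 0 < N p := by
    refine intervalIntegral.integral_pos hl (by fun_prop) (fun x _ => by positivity) ?_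
    by_cases h1 : p.1 = 0
    · have h2 : p.2 ≠ 0 := fun h2 => hp (Prod.ext h1 h2)
      refine ⟨l, ⟨hl.le, le_rfl⟩, ?_⟩
      have := mul_ne_zero h2 (sinSol_ne_zero hz hl)
      rw [sol, h1, zero_mul, zero_add]
      positivity
    · exact ⟨0, ⟨le_rfl, hl.le⟩, by rw [sol_zero]; positivity⟩
  obtain ⟨p, hp, hmin⟩ := (isCompact_sphere (0 : ℂ × ℂ) 1).exists_isMinOn
    (NormedSpace.sphere_nonempty.2 zero_le_one) hcont.continuousOn
  have hp0 : p ≠ 0 := by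
    rintro rfl
    simp at hp
  -- The norm on `ℂ × ℂ` is the maximum, so `‖a‖² + ‖b‖²` is at most twice its square; hence the
  -- factor `1/2`.
  refine ⟨N p / 2, half_pos (hpos p hp0), fun a b => ?_⟩
  by_cases h0 : ((a, b) : ℂ × ℂ) = 0
  · simp only [Prod.mk_eq_zero] at h0
    simp [h0.1, h0.2, sol]
  set r : ℝ := ‖((a, b) : ℂ × ℂ)‖ with hr
  have hr0 : 0 < r := norm_pos_iff.2 h0
  have h1 : ((r : ℂ)⁻¹ * a, (r : ℂ)⁻¹ * b) ∈ Metric.sphere (0 : ℂ × ℂ) 1 := by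
    have : ((r : ℂ)⁻¹ * a, (r : ℂ)⁻¹ * b) = (r : ℂ)⁻¹ • ((a, b) : ℂ × ℂ) := rfl
    rw [this, mem_sphere_zero_iff_norm, norm_smul, ← hr, norm_inv, Complex.norm_real,
      Real.norm_of_nonneg hr0.le, inv_mul_cancel₀ hr0.ne']
  have h2 : N p ≤ (r ^ 2)⁻¹ * N (a, b) := by
    refine (hmin h1).trans_eq ?_
    simp only [hN, ← intervalIntegral.integral_const_mul]
    congr 1
    ext x
    have : sol z ((r : ℂ)⁻¹ * a) ((r : ℂ)⁻¹ * b) x = (r : ℂ)⁻¹ * sol z a b x := by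
      unfold sol; ring
    rw [this, norm_mul, norm_inv, Complex.norm_real, Real.norm_of_nonneg hr0.le, mul_pow, inv_pow]
  have h3 : N p * r ^ 2 ≤ N (a, b) := by
    rwa [inv_mul_eq_div, le_div_iff₀ (by positivity)] at h2
  have h4 : ‖a‖ ≤ r := norm_fst_le (a, b)
  have h5 : ‖b‖ ≤ r := norm_snd_le (a, b)
  have h6 : ‖a‖ ^ 2 + ‖b‖ ^ 2 ≤ 2 * r ^ 2 := by
    have := pow_le_pow_left₀ (norm_nonneg a) h4 2
    have := pow_le_pow_left₀ (norm_nonneg b) h5 2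
    linarith
  have h7 := mul_le_mul_of_nonneg_left h6 (hpos p hp0).le
  change N p / 2 * (‖a‖ ^ 2 + ‖b‖ ^ 2) ≤ N (a, b)
  linarith

/-- The Wronskians of `f` with the two basic solutions are constant, and `cosSol² + z sinSol² = 1`
inverts the resulting linear system. -/
lemma IsH2.eq_sol (hz : 0 < z.im) {l : ℝ} {f f' f'' : ℝ → ℂ} (h : IsH2 l f f' f'')
    (he : ∀ᵐ x ∂(volume.restrict (Set.Icc 0 l)), -f'' x = z * f x) :
    ∀ x ∈ Set.Icc 0 l, f x = sol z (f 0) (f' 0) x ∧ f' x = dsol z (f 0) (f' 0) x := by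
  rcases lt_or_ge l 0 with hl | hl
  · simp [hl]
  have hi : IntegrableOn f'' (Set.Icc 0 l) volume := h.memLp.integrable (by norm_num)
  have hprim (g G : ℝ → ℂ) (hg : IntegrableOn g (Set.Icc 0 l) volume)
      (hG : ∀ x ∈ Set.Icc 0 l, G x = G 0 + ∫ t in (0 : ℝ)..x, g t) :
      ContinuousOn G (Set.Icc 0 l) := by
    have h1 := intervalIntegral.continuousOn_primitive_interval (μ := volume) (f := g) (a := 0)
      (b := l) (by rwa [Set.uIcc_of_le hl])
    rw [Set.uIcc_of_le hl] at h1
    exact (continuousOn_const.add h1).congr hG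
  have hc' : ContinuousOn f' (Set.Icc 0 l) := hprim f'' f' hi h.eq_integral'
  have hc : ContinuousOn f (Set.Icc 0 l) := hprim f' f hc'.integrableOn_Icc h.eq_integral
  have hd (g G : ℝ → ℂ) (hg : ContinuousOn g (Set.Icc 0 l))
      (hG : ∀ x ∈ Set.Icc 0 l, G x = G 0 + ∫ t in (0 : ℝ)..x, g t) :
      ∀ x ∈ Set.Ico 0 l, HasDerivWithinAt G (g x) (Set.Ici x) x := by
    intro x hx
    have hx' : x ∈ Set.Icc 0 l := Set.Ico_subset_Icc_self hx
    have hgr : ContinuousWithinAt g (Set.Ioi x) x :=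
      (hg x hx').mono_of_mem_nhdsWithin
        (Filter.mem_of_superset (Ioo_mem_nhdsGT hx.2)
          (fun y hy => ⟨hx.1.trans hy.1.le, hy.2.le⟩))
    have h1 : HasDerivWithinAt (fun u => ∫ t in (0 : ℝ)..u, g t) (g x) (Set.Ici x) x := by
      refine intervalIntegral.integral_hasDerivWithinAt_right
        (hg.mono ?_).intervalIntegrable ?_ hgr
      · rw [Set.uIcc_of_le hx.1]; exact Set.Icc_subset_Icc_right hx.2.le
      · exact ⟨Set.Ioo x l, Ioo_mem_nhdsGT hx.2,
          (hg.mono (fun y hy => ⟨hx.1.trans hy.1.le, hy.2.le⟩)).aestronglyMeasurable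
            measurableSet_Ioo⟩
    refine (h1.const_add (G 0)).congr_of_eventuallyEq ?_ (hG x hx')
    filter_upwards [Ico_mem_nhdsGE hx.2] with y hy
    exact hG y ⟨hx.1.trans hy.1, hy.2.le⟩
  -- Exchanging the weak derivative for the continuous function `-(z f)` makes `f'`
  -- right-differentiable at every point of `[0, l)`.
  have he' : ∀ x ∈ Set.Icc 0 l, f' x = f' 0 + ∫ t in (0 : ℝ)..x, -(z * f t) := by
    intro x hx
    rw [h.eq_integral' x hx]
    congr 1
    refine intervalIntegral.integral_congr_ae ?_
    rw [ae_restrict_iff' measurableSet_Icc] at he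
    filter_upwards [he] with t ht htx
    rw [Set.uIoc_of_le hx.1] at htx
    rw [← ht ⟨htx.1.le, htx.2.trans hx.2⟩, neg_neg]
  have hdf := hd f' f hc' h.eq_integral
  have hdf' := hd (fun t => -(z * f t)) f' (by fun_prop) he'
  have hu := constant_of_has_deriv_right_zero (a := 0) (b := l)
    (f := fun x => f x * cosSol z x - f' x * sinSol z x) (by fun_prop) (fun x hx => by
      refine (((hdf x hx).mul (hasDerivAt_cosSol hz x).hasDerivWithinAt).sub
        ((hdf' x hx).mul (hasDerivAt_sinSol hz x).hasDerivWithinAt)).congr_deriv ?_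
      ring)
  have hv := constant_of_has_deriv_right_zero (a := 0) (b := l)
    (f := fun x => z * f x * sinSol z x + f' x * cosSol z x) (by fun_prop) (fun x hx => by
      refine ((((hdf x hx).const_mul z).mul (hasDerivAt_sinSol hz x).hasDerivWithinAt).add
        ((hdf' x hx).mul (hasDerivAt_cosSol hz x).hasDerivWithinAt)).congr_deriv ?_
      ring)
  intro x hx
  have h1 := hu x hx
  have h2 := hv x hx
  have h3 := cosSol_sq_add hz x
  simp only [cosSol_zero, sinSol_zero, mul_one, mul_zero, sub_zero, zero_add] at h1 h2
  rw [sol, dsol, ← h1, ← h2]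
  constructor
  · linear_combination -(f x) * h3
  · linear_combination -(f' x) * h3

lemma isH2_sol (hz : 0 < z.im) (a b : ℂ) (l : ℝ) :
    IsH2 l (sol z a b) (dsol z a b) (fun x => -(z * sol z a b x)) where
  memLp := by
    have : ContinuousOn (fun x => -(z * sol z a b x)) (Set.Icc 0 l) := by fun_prop
    obtain ⟨C, hC⟩ := isCompact_Icc.exists_bound_of_continuousOn this
    exact MemLp.of_bound (this.aestronglyMeasurable measurableSet_Icc) C
      ((ae_restrict_iff' measurableSet_Icc).2 (Filter.Eventually.of_forall hC))
  eq_integral' x _ := by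
    rw [intervalIntegral.integral_eq_sub_of_hasDerivAt (fun y _ => hasDerivAt_dsol hz a b y)
      (Continuous.intervalIntegrable (by fun_prop) 0 x)]
    ring
  eq_integral x _ := by
    rw [intervalIntegral.integral_eq_sub_of_hasDerivAt (fun y _ => hasDerivAt_sol hz a b y)
      (Continuous.intervalIntegrable (by fun_prop) 0 x)]
    ring

end

/-! ### Cauchy data on the tree and uniqueness -/

section

variable {z : ℂ} {K : ℕ}

/-- The energy grows with the length, so one constant serves all edges and all realizations. -/
lemma exists_coercive_of_le (hz : 0 < z.im) {l₀ : ℝ} (hl : 0 < l₀) :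
    ∃ κ > 0, ∀ l, l₀ ≤ l → ∀ a b : ℂ,
      κ * (‖a‖ ^ 2 + ‖b‖ ^ 2) ≤ ∫ x in (0 : ℝ)..l, ‖sol z a b x‖ ^ 2 := by
  obtain ⟨κ, hκ, h⟩ := exists_coercive hz hl
  refine ⟨κ, hκ, fun l hle a b => (h a b).trans ?_⟩
  exact intervalIntegral.integral_mono_interval le_rfl hl.le hle
    (Filter.Eventually.of_forall fun x => by positivity)
    (Continuous.intervalIntegrable (by fun_prop) 0 l)

/-- The edges of generation `n`. -/
def level (K : ℕ) : ℕ → Finset (Edge K)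
  | 0 => {[]}
  | n + 1 => (level K n ×ˢ (Finset.univ : Finset (Fin K))).image fun p => p.2 :: p.1

lemma mem_level {n : ℕ} {e : Edge K} : e ∈ level K n ↔ e.length = n := by
  induction n generalizing e with
  | zero => simp [level]
  | succ n ih =>
    cases e with
    | nil => simp [level]
    | cons j e => simp [level, ih]

lemma sum_level_succ {M : Type*} [AddCommMonoid M] (f : Edge K → M) (n : ℕ) :
    ∑ e ∈ level K (n + 1), f e = ∑ e ∈ level K n, ∑ j, f (j :: e) := by
  rw [level, Finset.sum_image, Finset.sum_product]
  rintro ⟨e, j⟩ _ ⟨e', j'⟩ _ h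
  simp only [List.cons.injEq] at h
  exact Prod.ext h.2 h.1

/-- The Cauchy data `(ψ e 0, ψ' e 0)` of a solution on the tree: the vertex conditions in terms of
the transfer across the edges. -/
structure IsCauchyData (len : Edge K → ℝ) (z : ℂ) (a b : Edge K → ℂ) : Prop where
  continuous_vertex : ∀ e j, a (j :: e) = sol z (a e) (b e) (len e)
  kirchhoff : ∀ e, ∑ j, b (j :: e) = dsol z (a e) (b e) (len e)

/-- The squared `L²` norm on the edge `e` of the solution with given Cauchy data. -/
def edgeEnergy (len : Edge K → ℝ) (z : ℂ) (a b : Edge K → ℂ) (e : Edge K) : ℝ :=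
  ∫ x in (0 : ℝ)..len e, ‖sol z (a e) (b e) x‖ ^ 2

variable {len : Edge K → ℝ} {a b : Edge K → ℂ}

lemma edgeEnergy_nonneg (hlen : ∀ e, 0 < len e) (e : Edge K) : 0 ≤ edgeEnergy len z a b e :=
  intervalIntegral.integral_nonneg (hlen e).le fun _ _ => by positivity

lemma lintegral_eq_ofReal_edgeEnergy (hlen : ∀ e, 0 < len e) {ψ : ℝ → ℂ} {e : Edge K}
    (h : ∀ x ∈ Set.Icc 0 (len e), ψ x = sol z (a e) (b e) x) :
    ∫⁻ x in Set.Icc 0 (len e), ‖ψ x‖ₑ ^ 2 = ENNReal.ofReal (edgeEnergy len z a b e) := by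
  rw [edgeEnergy, intervalIntegral.integral_of_le (hlen e).le, ← integral_Icc_eq_integral_Ioc,
    ofReal_integral_eq_lintegral_ofReal
      (ContinuousOn.integrableOn_Icc (Continuous.continuousOn (by fun_prop)))
      (Filter.Eventually.of_forall fun x => by positivity)]
  refine setLIntegral_congr_fun measurableSet_Icc fun x hx => ?_
  rw [h x hx, ← ofReal_norm, ENNReal.ofReal_pow (norm_nonneg _)]

/-- The current identity summed over the first `N` generations. -/
lemma IsCauchyData.current_sum (h : IsCauchyData len z a b) (hz : 0 < z.im) (N : ℕ) :
    (star (a []) * b []).im = z.im * ∑ n ∈ Finset.range N, ∑ e ∈ level K n, edgeEnergy len z a b e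
      + ∑ e ∈ level K N, (star (a e) * b e).im := by
  induction N with
  | zero => simp [level]
  | succ N ih =>
    rw [ih, Finset.sum_range_succ, mul_add, add_assoc, sum_level_succ]
    congr 1
    rw [Finset.mul_sum, ← Finset.sum_add_distrib]
    refine Finset.sum_congr rfl fun e _ => ?_
    have h1 := current_identity hz (a e) (b e) (len e)
    rw [← h.kirchhoff e, Finset.mul_sum, Complex.im_sum] at h1
    rw [edgeEnergy, ← h1]
    simp only [h.continuous_vertex]
    ring

lemma sum_subset_levels {f : Edge K → ℝ} (hf : ∀ e, 0 ≤ f e) (u : Finset (Edge K)) :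
    ∃ N₀, ∀ N ≥ N₀, ∑ e ∈ u, f e ≤ ∑ n ∈ Finset.range N, ∑ e ∈ level K n, f e := by
  refine ⟨u.sup List.length + 1, fun N hN => ?_⟩
  rw [← Finset.sum_biUnion]
  · refine Finset.sum_le_sum_of_subset_of_nonneg (fun e he => ?_) fun e _ _ => hf e
    rw [Finset.mem_biUnion]
    refine ⟨e.length, Finset.mem_range.2 ?_, mem_level.2 rfl⟩
    have := Finset.le_sup (f := List.length) he
    omega
  · intro m _ n _ hmn
    refine Finset.disjoint_left.2 fun e h1 h2 => hmn ?_
    rw [← mem_level.1 h1, mem_level.1 h2]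

lemma tendsto_sum_level {f : Edge K → ℝ} (hf : Summable f) :
    Filter.Tendsto (fun n => ∑ e ∈ level K n, f e) Filter.atTop (nhds 0) := by
  rw [Metric.tendsto_atTop]
  intro ε hε
  obtain ⟨s, hs⟩ := summable_iff_vanishing_norm.1 hf ε hε
  refine ⟨s.sup List.length + 1, fun n hn => ?_⟩
  rw [dist_zero_right]
  refine hs _ (Finset.disjoint_left.2 fun e h1 h2 => ?_)
  have := Finset.le_sup (f := List.length) h2
  have := mem_level.1 h1
  omega

/-- A square-integrable solution that vanishes at the root vanishes. -/
lemma IsCauchyData.eq_zero (h : IsCauchyData len z a b) (hz : 0 < z.im) {l₀ : ℝ} (hl₀ : 0 < l₀)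
    (hlen : ∀ e, l₀ ≤ len e) (hs : Summable (edgeEnergy len z a b)) (h0 : a [] = 0) (e : Edge K) :
    a e = 0 ∧ b e = 0 := by
  obtain ⟨κ, hκ, hco⟩ := exists_coercive_of_le hz hl₀
  have hE (e : Edge K) : κ * (‖a e‖ ^ 2 + ‖b e‖ ^ 2) ≤ edgeEnergy len z a b e :=
    hco _ (hlen e) _ _
  -- By coercivity the current through generation `N` is at most `κ⁻¹` times the energy of that
  -- generation, which tends to zero.
  have hlim : Filter.Tendsto (fun N => ∑ e ∈ level K N, (star (a e) * b e).im)
      Filter.atTop (nhds 0) := by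
    refine squeeze_zero_norm (fun N => ?_) (by simpa using (tendsto_sum_level hs).const_mul κ⁻¹)
    rw [Finset.mul_sum]
    refine (norm_sum_le _ _).trans (Finset.sum_le_sum fun e _ => ?_)
    rw [inv_mul_eq_div, le_div_iff₀ hκ]
    refine le_trans ?_ (hE e)
    rw [mul_comm]
    refine mul_le_mul_of_nonneg_left ?_ hκ.le
    refine (Complex.abs_im_le_norm _).trans ?_
    rw [norm_mul, norm_star]
    nlinarith [sq_nonneg (‖a e‖ - ‖b e‖), sq_nonneg ‖a e‖, sq_nonneg ‖b e‖]
  obtain ⟨N₀, hN₀⟩ := sum_subset_levels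
    (edgeEnergy_nonneg (z := z) (a := a) (b := b) fun e => hl₀.trans_le (hlen e)) {e}
  -- No current enters at the root and none escapes in the limit, so no energy is left for `e`.
  have hle : z.im * edgeEnergy len z a b e + 0 ≤ 0 := by
    refine le_of_tendsto (hlim.const_add (z.im * edgeEnergy len z a b e)) ?_
    filter_upwards [Filter.eventually_ge_atTop N₀] with N hN
    have h1 := h.current_sum hz N
    have h2 := hN₀ N hN
    rw [Finset.sum_singleton] at h2
    rw [h0, star_zero, zero_mul, Complex.zero_im] at h1
    have := mul_le_mul_of_nonneg_left h2 hz.le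
    linarith
  have h3 : edgeEnergy len z a b e ≤ 0 := by
    by_contra! h4
    have := mul_pos hz h4
    linarith
  have h4 : ‖a e‖ ^ 2 + ‖b e‖ ^ 2 ≤ 0 := by
    by_contra! h5
    have := mul_pos hκ h5
    linarith [hE e]
  constructor
  · exact norm_eq_zero.1 (pow_eq_zero_iff two_ne_zero |>.1 (by nlinarith [sq_nonneg ‖a e‖, sq_nonneg ‖b e‖]))
  · exact norm_eq_zero.1 (pow_eq_zero_iff two_ne_zero |>.1 (by nlinarith [sq_nonneg ‖a e‖, sq_nonneg ‖b e‖]))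

lemma IsCauchyData.sub {a' b' : Edge K → ℂ} (h : IsCauchyData len z a b)
    (h' : IsCauchyData len z a' b') :
    IsCauchyData len z (fun e => a e - a' e) (fun e => b e - b' e) where
  continuous_vertex e j := by rw [h.continuous_vertex, h'.continuous_vertex]; unfold sol; ring
  kirchhoff e := by rw [Finset.sum_sub_distrib, h.kirchhoff, h'.kirchhoff]; unfold dsol; ring

lemma summable_edgeEnergy_sub {a' b' : Edge K → ℂ} (hlen : ∀ e, 0 < len e)
    (h : Summable (edgeEnergy len z a b)) (h' : Summable (edgeEnergy len z a' b')) :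
    Summable (edgeEnergy len z (fun e => a e - a' e) (fun e => b e - b' e)) := by
  refine Summable.of_nonneg_of_le (edgeEnergy_nonneg hlen) (fun e => ?_)
    ((h.mul_left 2).add (h'.mul_left 2))
  simp only [edgeEnergy]
  rw [← intervalIntegral.integral_const_mul, ← intervalIntegral.integral_const_mul,
    ← intervalIntegral.integral_add (Continuous.intervalIntegrable (by fun_prop) _ _)
      (Continuous.intervalIntegrable (by fun_prop) _ _)]
  refine intervalIntegral.integral_mono_on (hlen e).le
    (Continuous.intervalIntegrable (by fun_prop) _ _)
    (Continuous.intervalIntegrable (by fun_prop) _ _) fun x _ => ?_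
  have : sol z (a e - a' e) (b e - b' e) x = sol z (a e) (b e) x - sol z (a' e) (b' e) x := by
    unfold sol; ring
  rw [this]
  have h1 := norm_sub_le (sol z (a e) (b e) x) (sol z (a' e) (b' e) x)
  have h2 := pow_le_pow_left₀ (norm_nonneg _) h1 2
  nlinarith [sq_nonneg (‖sol z (a e) (b e) x‖ - ‖sol z (a' e) (b' e) x‖)]

/-- The Cauchy data of a square-integrable solution. -/
lemma IsL2Solution.cauchyData {ψ ψ' : Edge K → ℝ → ℂ} (h : IsL2Solution len z ψ ψ')
    (hz : 0 < z.im) (hlen : ∀ e, 0 < len e) :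
    IsCauchyData len z (fun e => ψ e 0) (fun e => ψ' e 0) ∧
      Summable (edgeEnergy len z (fun e => ψ e 0) (fun e => ψ' e 0)) := by
  have hsol (e : Edge K) : ∀ x ∈ Set.Icc 0 (len e),
      ψ e x = sol z (ψ e 0) (ψ' e 0) x ∧ ψ' e x = dsol z (ψ e 0) (ψ' e 0) x := by
    obtain ⟨ψ'', h1, h2⟩ := h.eqn e
    exact h1.eq_sol hz h2
  have hend (e : Edge K) : len e ∈ Set.Icc 0 (len e) := ⟨(hlen e).le, le_rfl⟩
  refine ⟨⟨fun e j => ?_, fun e => ?_⟩, ?_⟩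
  · rw [h.continuous_vertex, ← (hsol e _ (hend e)).1]
  · rw [← h.kirchhoff, ← (hsol e _ (hend e)).2]
  · have h1 := h.square_integrable
    have h2 (e : Edge K) := lintegral_eq_ofReal_edgeEnergy (z := z) (a := fun e => ψ e 0)
      (b := fun e => ψ' e 0) hlen (ψ := ψ e) (e := e) fun x hx => (hsol e x hx).1
    simp only [h2] at h1
    refine (ENNReal.summable_toReal h1.ne).congr fun e => ?_
    rw [ENNReal.toReal_ofReal (edgeEnergy_nonneg hlen e)]

lemma IsCauchyData.isL2Solution (h : IsCauchyData len z a b) (hz : 0 < z.im)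
    (hlen : ∀ e, 0 < len e) (hs : Summable (edgeEnergy len z a b)) :
    IsL2Solution len z (fun e => sol z (a e) (b e)) (fun e => dsol z (a e) (b e)) where
  eqn e := ⟨_, isH2_sol hz _ _ _, Filter.Eventually.of_forall fun x => by simp⟩
  continuous_vertex e j := by rw [sol_zero, h.continuous_vertex]
  kirchhoff e := by simp only [dsol_zero, h.kirchhoff]
  square_integrable := by
    have h2 (e : Edge K) := lintegral_eq_ofReal_edgeEnergy (z := z) (a := a) (b := b) hlen
      (ψ := sol z (a e) (b e)) (e := e) fun x _ => rfl
    simp only [h2]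
    exact hs.tsum_ofReal_lt_top

end

/-! ### Riccati equations and the Weyl-Titchmarsh function -/

section

variable {z : ℂ} {K : ℕ} {len : Edge K → ℝ}

/-- The Riccati equation at the far end of the edge `e`, for a family `R e` of logarithmic
derivatives at the near ends of the edges. -/
def RiccatiAt (len : Edge K → ℝ) (z : ℂ) (R : Edge K → ℂ) (e : Edge K) : Prop :=
  (∑ j, R (j :: e)) * sol z 1 (R e) (len e) = dsol z 1 (R e) (len e)

/-- The closed upper half-disc of radius `C`. -/
def halfDisc (C : ℝ) : Set ℂ := Metric.closedBall 0 C ∩ {r | 0 ≤ r.im}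

lemma isCompact_halfDisc (C : ℝ) : IsCompact (halfDisc C) :=
  (isCompact_closedBall 0 C).inter_right (isClosed_le continuous_const Complex.continuous_im)

lemma mem_halfDisc {C : ℝ} {r : ℂ} : r ∈ halfDisc C ↔ ‖r‖ ≤ C ∧ 0 ≤ r.im := by
  simp [halfDisc]

/-- The values at the near ends of the edges of the function with logarithmic derivatives `R`. -/
def valueOf (len : Edge K → ℝ) (z : ℂ) (R : Edge K → ℂ) : Edge K → ℂ
  | [] => 1
  | _ :: e => valueOf len z R e * sol z 1 (R e) (len e)

lemma sol_smul (c a b : ℂ) (x : ℝ) : sol z (c * a) (c * b) x = c * sol z a b x := by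
  unfold sol; ring

lemma dsol_smul (c a b : ℂ) (x : ℝ) : dsol z (c * a) (c * b) x = c * dsol z a b x := by
  unfold dsol; ring

lemma isCauchyData_of_riccati {R : Edge K → ℂ} (hR : ∀ e, RiccatiAt len z R e) :
    IsCauchyData len z (valueOf len z R) (fun e => valueOf len z R e * R e) where
  continuous_vertex e j := by
    have := sol_smul (z := z) (valueOf len z R e) 1 (R e) (len e)
    rw [mul_one] at this
    rw [this, valueOf]
  kirchhoff e := by
    have := dsol_smul (z := z) (valueOf len z R e) 1 (R e) (len e)
    rw [mul_one] at this
    rw [this, ← hR e]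
    simp only [valueOf, ← Finset.mul_sum]
    ring

lemma star_mul_self_mul_im (a r : ℂ) : (star a * (a * r)).im = ‖a‖ ^ 2 * r.im := by
  rw [← mul_assoc, Complex.star_def, ← Complex.normSq_eq_conj_mul_self, Complex.im_ofReal_mul,
    Complex.normSq_eq_norm_sq]

/-- The current through each generation is nonnegative, so the energy of finitely many generations
never exceeds the root current over `Im z`. -/
lemma summable_of_riccati (hz : 0 < z.im) (hlen : ∀ e, 0 < len e) {R : Edge K → ℂ}
    (hR : ∀ e, RiccatiAt len z R e) (him : ∀ e, 0 ≤ (R e).im) :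
    Summable (edgeEnergy len z (valueOf len z R) (fun e => valueOf len z R e * R e)) := by
  refine summable_of_sum_le (c := (R []).im / z.im) (edgeEnergy_nonneg hlen) fun u => ?_
  obtain ⟨N, hN⟩ := sum_subset_levels (edgeEnergy_nonneg (z := z) (a := valueOf len z R)
    (b := fun e => valueOf len z R e * R e) hlen) u
  refine (hN N le_rfl).trans ?_
  rw [le_div_iff₀ hz, mul_comm]
  have h := (isCauchyData_of_riccati hR).current_sum hz N
  simp only [star_mul_self_mul_im] at h
  have h2 : 0 ≤ ∑ e ∈ level K N, ‖valueOf len z R e‖ ^ 2 * (R e).im :=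
    Finset.sum_nonneg fun e _ => mul_nonneg (by positivity) (him e)
  simp only [valueOf, norm_one, one_pow, one_mul] at h
  linarith

/-- Existence and uniqueness of the normalized square-integrable solution, in terms of a solution
of the Riccati equations. -/
lemma psi_eq_of_riccati (hz : 0 < z.im) {l₀ : ℝ} (hl₀ : 0 < l₀) (hlen : ∀ e, l₀ ≤ len e)
    {R : Edge K → ℂ} (hR : ∀ e, RiccatiAt len z R e) (him : ∀ e, 0 ≤ (R e).im) (e : Edge K) :
    psiPlus len z e 0 = valueOf len z R e ∧ psiPlusDeriv len z e 0 = valueOf len z R e * R e := by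
  have hpos (e : Edge K) : 0 < len e := hl₀.trans_le (hlen e)
  have hs := summable_of_riccati hz hpos hR him
  have hd := isCauchyData_of_riccati hR
  have hex : ∃ p : (Edge K → ℝ → ℂ) × (Edge K → ℝ → ℂ),
      IsL2Solution len z p.1 p.2 ∧ p.1 [] 0 = 1 :=
    ⟨(_, _), hd.isL2Solution hz hpos hs, by simp [valueOf]⟩
  -- Existence gives the chosen pair its defining properties; uniqueness then identifies its Cauchy
  -- data.
  obtain ⟨h1, h2⟩ := Classical.epsilon_spec hex
  obtain ⟨h3, h4⟩ := h1.cauchyData hz hpos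
  have h5 := (h3.sub hd).eq_zero hz hl₀ hlen (summable_edgeEnergy_sub hpos h4 hs)
    (by simp only [h2, valueOf, sub_self]) e
  exact ⟨sub_eq_zero.1 h5.1, sub_eq_zero.1 h5.2⟩

lemma RPlus_eq_of_riccati (hz : 0 < z.im) {l₀ : ℝ} (hl₀ : 0 < l₀) (hlen : ∀ e, l₀ ≤ len e)
    {R : Edge K → ℂ} (hR : ∀ e, RiccatiAt len z R e) (him : ∀ e, 0 ≤ (R e).im) :
    RPlus len z [] 0 = R [] := by
  obtain ⟨h1, h2⟩ := psi_eq_of_riccati hz hl₀ hlen hR him []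
  rw [RPlus, h1, h2]
  simp [valueOf]

lemma im_star_mul (s t : ℂ) (W : ℂ) (h : W * s = t) : (star s * t).im = ‖s‖ ^ 2 * W.im := by
  rw [← h, mul_comm W s, star_mul_self_mul_im]

/-- A priori bounds for solutions of the Riccati equation on one edge. -/
lemma riccati_bounds (hz : 0 < z.im) {κ l : ℝ} (hκ : 0 < κ)
    (hco : ∀ a b : ℂ, κ * (‖a‖ ^ 2 + ‖b‖ ^ 2) ≤ ∫ x in (0 : ℝ)..l, ‖sol z a b x‖ ^ 2)
    {W r : ℂ} (hW : 0 ≤ W.im) (h : W * sol z 1 r l = dsol z 1 r l) :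
    z.im * κ ≤ r.im ∧ ‖r‖ ≤ (z.im * κ)⁻¹ ∧ ‖sol z 1 r l‖ ^ 2 * W.im ≤ r.im := by
  have h1 := current_identity hz 1 r l
  rw [im_star_mul _ _ W h, star_one, one_mul] at h1
  have h2 := mul_le_mul_of_nonneg_left (hco 1 r) hz.le
  rw [← h1, norm_one, one_pow, ← mul_assoc] at h2
  have h3 : 0 ≤ ‖sol z 1 r l‖ ^ 2 * W.im := by positivity
  have h4 : 0 < z.im * κ := by positivity
  have h5 : 0 ≤ z.im * κ * ‖r‖ ^ 2 := by positivity
  have h6 := (le_abs_self _).trans (Complex.abs_im_le_norm r)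
  -- The far current is nonnegative, so `Im z κ (1 + ‖r‖²) ≤ Im r ≤ ‖r‖`, which contains both bounds
  -- on `r`.
  refine ⟨by linarith, ?_, ?_⟩
  · rw [inv_eq_one_div, le_div_iff₀ h4]
    by_contra! h7
    have : 0 < ‖r‖ := by
      by_contra! h8
      nlinarith
    nlinarith
  · nlinarith

/-- The data `(1, W)` at the far end are carried back by the inverse transfer matrix, of determinant
`1`, and `r` is the quotient. The value at the near end cannot vanish: the current there would be
zero, which with `Im W ≥ 0` forces zero energy. -/
lemma exists_riccati_step (hz : 0 < z.im) {κ l : ℝ} (hκ : 0 < κ)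
    (hco : ∀ a b : ℂ, κ * (‖a‖ ^ 2 + ‖b‖ ^ 2) ≤ ∫ x in (0 : ℝ)..l, ‖sol z a b x‖ ^ 2)
    {W : ℂ} (hW : 0 ≤ W.im) : ∃ r ∈ halfDisc (z.im * κ)⁻¹, W * sol z 1 r l = dsol z 1 r l := by
  have hcs := cosSol_sq_add hz l
  set a : ℂ := cosSol z l - sinSol z l * W with ha
  set b : ℂ := z * sinSol z l + cosSol z l * W with hb
  have h1 : sol z a b l = 1 := by rw [sol, ha, hb]; linear_combination hcs
  have h2 : dsol z a b l = W := by rw [dsol, ha, hb]; linear_combination W * hcs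
  have ha0 : a ≠ 0 := by
    intro h0
    have h3 := current_identity hz a b l
    rw [h1, h2, h0, star_zero, zero_mul, Complex.zero_im, star_one, one_mul] at h3
    have h4 := mul_le_mul_of_nonneg_left (hco 0 b) hz.le
    rw [norm_zero, ← h3] at h4
    have h5 : ‖b‖ ^ 2 ≤ 0 := by
      by_contra! h6
      have := mul_pos hz (mul_pos hκ h6)
      simp only [ne_eq, OfNat.ofNat_ne_zero, not_false_eq_true, zero_pow, zero_add] at h4
      linarith
    have h6 : b = 0 := norm_eq_zero.1 (pow_eq_zero_iff two_ne_zero |>.1 (le_antisymm h5 (sq_nonneg _)))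
    rw [h0, h6] at h1
    simp [sol] at h1
  have h3 : W * sol z 1 (b / a) l = dsol z 1 (b / a) l := by
    apply mul_left_cancel₀ ha0
    rw [← dsol_smul, mul_left_comm, ← sol_smul, mul_one, mul_div_cancel₀ _ ha0, h1, h2, mul_one]
  obtain ⟨h4, h5, -⟩ := riccati_bounds hz hκ hco hW h3
  exact ⟨b / a, mem_halfDisc.2 ⟨h5, (by positivity : 0 ≤ z.im * κ).trans h4⟩, h3⟩

lemma continuous_sol_pair : Continuous fun p : ℂ × ℝ => sol z 1 p.1 p.2 := by
  unfold sol; fun_prop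

lemma continuous_dsol_pair : Continuous fun p : ℂ × ℝ => dsol z 1 p.1 p.2 := by
  unfold dsol; fun_prop

/-- Closedness is joint: existence uses it with the lengths fixed, continuity of `RPlus` with the
lengths varying. -/
lemma isClosed_riccatiAt (z : ℂ) (e : Edge K) :
    IsClosed {p : (Edge K → ℝ) × (Edge K → ℂ) | RiccatiAt p.1 z p.2 e} := by
  have hp : Continuous fun p : (Edge K → ℝ) × (Edge K → ℂ) => (p.2 e, p.1 e) :=
    ((continuous_apply e).comp continuous_snd).prodMk ((continuous_apply e).comp continuous_fst)
  have hsum : Continuous fun p : (Edge K → ℝ) × (Edge K → ℂ) => ∑ j, p.2 (j :: e) :=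
    continuous_finsetSum _ fun j _ => (continuous_apply (j :: e)).comp continuous_snd
  have h1 := (continuous_sol_pair (z := z)).comp hp
  have h2 := (continuous_dsol_pair (z := z)).comp hp
  simp only [RiccatiAt]
  exact isClosed_eq (hsum.mul h1) h2

/-- Solvability of the Riccati equations on the whole tree. -/
lemma exists_riccati (hz : 0 < z.im) {κ : ℝ} (hκ : 0 < κ)
    (hco : ∀ e, ∀ a b : ℂ,
      κ * (‖a‖ ^ 2 + ‖b‖ ^ 2) ≤ ∫ x in (0 : ℝ)..len e, ‖sol z a b x‖ ^ 2) :
    ∃ R : Edge K → ℂ, (∀ e, R e ∈ halfDisc (z.im * κ)⁻¹) ∧ ∀ e, RiccatiAt len z R e := by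
  set C := (z.im * κ)⁻¹
  set B : Set (Edge K → ℂ) := Set.univ.pi fun _ => halfDisc C
  have hB : IsCompact B := isCompact_univ_pi fun _ => isCompact_halfDisc C
  -- These sets solve the equations in the first `n` generations. They are compact, decreasing and
  -- nonempty, and a common point solves all equations.
  set t : ℕ → Set (Edge K → ℂ) := fun n => B ∩ {R | ∀ e, e.length < n → RiccatiAt len z R e}
  have hcl (n : ℕ) : IsClosed (t n) := by
    refine hB.isClosed.inter ?_
    simp only [Set.ofPred_forall]
    refine isClosed_iInter fun e => isClosed_iInter fun _ => ?_
    exact (isClosed_riccatiAt z e).preimage (by fun_prop : Continuous fun R => (len, R))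
  have hne (n : ℕ) : (t n).Nonempty := by
    -- The equations are solved from generation `n - 1` back to generation `m`, starting from `R =
    -- 0`.
    have key (k : ℕ) : ∀ m, m + k = n →
        ∃ R ∈ B, ∀ e : Edge K, m ≤ e.length → e.length < n → RiccatiAt len z R e := by
      induction k with
      | zero =>
        intro m hm
        refine ⟨0, fun e _ => mem_halfDisc.2 ?_, fun e h1 h2 => by omega⟩
        simp only [Pi.zero_apply, norm_zero, Complex.zero_im, le_refl, and_true]
        positivity
      | succ k ih =>
        intro m hm
        obtain ⟨R, hR, hRic⟩ := ih (m + 1) (by omega)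
        have hW (e : Edge K) : 0 ≤ (∑ j, R (j :: e)).im := by
          rw [Complex.im_sum]
          exact Finset.sum_nonneg fun j _ => (mem_halfDisc.1 (hR _ trivial)).2
        choose r hr hr' using fun e => exists_riccati_step hz hκ (hco e) (hW e)
        -- The equation at `e` involves only `e` and its children, so a change in generation `m`
        -- leaves the later equations intact.
        refine ⟨fun e => if e.length = m then r e else R e, fun e _ => ?_, fun e h1 h2 => ?_⟩
        · dsimp only
          split_ifs
          exacts [hr e, hR e trivial]
        · have hch (j : Fin K) : (j :: e).length ≠ m := by simp only [List.length_cons]; omega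
          simp only [RiccatiAt, hch, if_false]
          split_ifs with h3
          · exact hr' e
          · exact hRic e (by omega) h2
    obtain ⟨R, hR, h⟩ := key n 0 (by omega)
    exact ⟨R, hR, fun e he => h e (Nat.zero_le _) he⟩
  obtain ⟨R, hR⟩ := IsCompact.nonempty_iInter_of_sequence_nonempty_isCompact_isClosed t
    (fun n R hR => ⟨hR.1, fun e he => hR.2 e (by omega)⟩) hne (hB.of_isClosed_subset (hcl 0)
      Set.inter_subset_left) hcl
  rw [Set.mem_iInter] at hR
  exact ⟨R, fun e => (hR 0).1 e trivial, fun e => (hR (e.length + 1)).2 e (by omega)⟩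

/-- The logarithmic derivative at the root depends continuously on the edge lengths. -/
lemma continuous_RPlus {T : Type*} [TopologicalSpace T] (hz : 0 < z.im) {l₀ : ℝ} (hl₀ : 0 < l₀)
    {len : T → Edge K → ℝ} (hlen : ∀ t e, l₀ ≤ len t e) (hcont : Continuous len) :
    Continuous fun t => RPlus (len t) z [] 0 := by
  obtain ⟨κ, hκ, hco⟩ := exists_coercive_of_le hz hl₀
  set B : Set (Edge K → ℂ) := Set.univ.pi fun _ => halfDisc (z.im * κ)⁻¹
  have : CompactSpace B :=
    isCompact_iff_compactSpace.1 (isCompact_univ_pi fun _ => isCompact_halfDisc _)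
  have hB (R : B) (e : Edge K) : 0 ≤ (R.1 e).im := (mem_halfDisc.1 (R.2 e trivial)).2
  rw [continuous_iff_isClosed]
  intro F hF
  -- Projection along the compact `B` is a closed map. By uniqueness of the root value, the
  -- projection of this set is the preimage of `F`.
  have hcl : IsClosed {p : T × B | (∀ e, RiccatiAt (len p.1) z p.2.1 e) ∧ p.2.1 [] ∈ F} := by
    have h1 : Continuous fun p : T × B => p.2.1 := continuous_subtype_val.comp continuous_snd
    have h2 : IsClosed {p : T × B | ∀ e, RiccatiAt (len p.1) z p.2.1 e} := by
      simp only [Set.ofPred_forall]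
      exact isClosed_iInter fun e => (isClosed_riccatiAt z e).preimage
        ((hcont.comp continuous_fst).prodMk h1)
    exact h2.inter (hF.preimage ((continuous_apply []).comp h1))
  convert isClosedMap_fst_of_compactSpace _ hcl using 1
  ext t
  simp only [Set.mem_preimage, Set.mem_image, Set.mem_ofPred_eq, Prod.exists, exists_and_right,
    exists_eq_right]
  constructor
  · intro ht
    obtain ⟨R, hR, hRic⟩ := exists_riccati hz hκ (len := len t) fun e => hco _ (hlen t e)
    refine ⟨⟨R, fun e _ => hR e⟩, hRic, ?_⟩
    have := RPlus_eq_of_riccati hz hl₀ (hlen t) hRic fun e => (mem_halfDisc.1 (hR e)).2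
    change R [] ∈ F
    rwa [← this]
  · rintro ⟨R, hRic, hF⟩
    rwa [RPlus_eq_of_riccati hz hl₀ (hlen t) hRic (hB R)]

/-- The properties of the Weyl-Titchmarsh function at the root used for the width bounds. -/
lemma RPlus_properties (hz : 0 < z.im) {l₀ κ : ℝ} (hl₀ : 0 < l₀) (hκ : 0 < κ)
    (hco : ∀ l, l₀ ≤ l → ∀ a b : ℂ,
      κ * (‖a‖ ^ 2 + ‖b‖ ^ 2) ≤ ∫ x in (0 : ℝ)..l, ‖sol z a b x‖ ^ 2)
    (hlen : ∀ e, l₀ ≤ len e) :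
    z.im * κ ≤ (RPlus len z [] 0).im ∧ ‖RPlus len z [] 0‖ ≤ (z.im * κ)⁻¹ ∧
    RiccatiAt len z (fun e => RPlus (fun f => len (f ++ e)) z [] 0) [] ∧
    ∀ j, psiPlus len z [j] 0 / psiPlus len z [] 0 = sol z 1 (RPlus len z [] 0) (len []) := by
  obtain ⟨R, hR, hRic⟩ := exists_riccati hz hκ fun e => hco _ (hlen e)
  have him (e : Edge K) : 0 ≤ (R e).im := (mem_halfDisc.1 (hR e)).2
  -- The words `f ++ e` code the subtree starting at `e`, on which `R` restricts to a Riccati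
  -- solution.
  have hsub (e : Edge K) : RPlus (fun f => len (f ++ e)) z [] 0 = R e :=
    RPlus_eq_of_riccati hz hl₀ (fun f => hlen _) (R := fun f => R (f ++ e))
      (fun f => hRic (f ++ e)) (fun f => him _)
  have hroot := RPlus_eq_of_riccati hz hl₀ hlen hRic him
  obtain ⟨h1, h2, -⟩ := riccati_bounds hz hκ (hco _ (hlen []))
    (by rw [Complex.im_sum]; exact Finset.sum_nonneg fun j _ => him _) (hRic [])
  rw [hroot]
  refine ⟨h1, h2, ?_, fun j => ?_⟩
  · simp only [hsub]
    exact hRic []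
  · rw [(psi_eq_of_riccati hz hl₀ hlen hRic him [j]).1,
      (psi_eq_of_riccati hz hl₀ hlen hRic him []).1]
    simp [valueOf]

end

/-! ### Quantiles, relative width and concavity of the logarithm -/

section

variable {Ω : Type*} [MeasurableSpace Ω] {P : Measure Ω}

/-- Reflection turns each fact about lower quantiles into one about upper quantiles. -/
lemma xiPlus_eq_neg (P : Measure Ω) (X : Ω → ℝ) (a : ℝ) :
    xiPlus P X a = -xiMinus P (fun x => -X x) a := by
  rw [xiPlus, xiMinus, Real.sInf_def]
  congr 2
  ext ξ
  simp only [Set.mem_neg, Set.mem_ofPred_eq, neg_lt]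

lemma mem_xiMinus_of_le {X : Ω → ℝ} {m a : ℝ} (hm : ∀ x, m ≤ X x) (ha : 0 ≤ a) :
    m ∈ {ξ : ℝ | P.real {x | X x < ξ} ≤ a} := by
  have : {x | X x < m} = ∅ := Set.eq_empty_of_forall_notMem fun x hx => (hm x).not_gt hx
  rw [Set.mem_ofPred_eq, this, measureReal_empty]
  exact ha

section Quantiles

variable [IsProbabilityMeasure P] {X : Ω → ℝ} {m M a : ℝ}

lemma bddAbove_xiMinus (hM : ∀ x, X x ≤ M) (ha : a < 1) :
    BddAbove {ξ : ℝ | P.real {x | X x < ξ} ≤ a} := by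
  refine ⟨M, fun ξ hξ => ?_⟩
  by_contra! h
  have : {x | X x < ξ} = Set.univ := Set.eq_univ_of_forall fun x => (hM x).trans_lt h
  rw [Set.mem_ofPred_eq, this, probReal_univ] at hξ
  linarith

lemma le_xiMinus (hM : ∀ x, X x ≤ M) (ha : a < 1) {ξ : ℝ} (h : P.real {x | X x < ξ} ≤ a) :
    ξ ≤ xiMinus P X a :=
  le_csSup (bddAbove_xiMinus hM ha) h

lemma xiMinus_le (hm : ∀ x, m ≤ X x) (hM : ∀ x, X x ≤ M) (ha : 0 ≤ a) (ha' : a < 1) :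
    xiMinus P X a ≤ M := by
  refine csSup_le ⟨m, mem_xiMinus_of_le hm ha⟩ fun ξ hξ => ?_
  by_contra! h
  have : {x | X x < ξ} = Set.univ := Set.eq_univ_of_forall fun x => (hM x).trans_lt h
  rw [Set.mem_ofPred_eq, this, probReal_univ] at hξ
  linarith

/-- Continuity of the measure from below: the supremum belongs to its set. -/
lemma measureReal_lt_xiMinus_le (hm : ∀ x, m ≤ X x) (ha : 0 ≤ a) :
    P.real {x | X x < xiMinus P X a} ≤ a := by
  set ξ := xiMinus P X a with hξ
  have hset : {x | X x < ξ} = ⋃ n : ℕ, {x | X x < ξ - 1 / ((n : ℝ) + 1)} := by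
    ext x
    simp only [Set.mem_ofPred_eq, Set.mem_iUnion]
    refine ⟨fun h => ?_, fun ⟨n, h⟩ => h.trans (sub_lt_self _ (by positivity))⟩
    obtain ⟨n, hn⟩ := exists_nat_one_div_lt (sub_pos.2 h)
    exact ⟨n, by linarith⟩
  have hmono : Monotone fun n : ℕ => {x | X x < ξ - 1 / ((n : ℝ) + 1)} := by
    intro n k hnk x (hx : X x < _)
    refine lt_of_lt_of_le hx ?_
    have := Nat.one_div_le_one_div (α := ℝ) hnk
    linarith
  have h1 := tendsto_measure_iUnion_atTop (μ := P) hmono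
  rw [← hset] at h1
  have h2 := (ENNReal.tendsto_toReal (measure_ne_top P _)).comp h1
  refine le_of_tendsto' h2 fun n => ?_
  obtain ⟨η, hη, hlt⟩ := exists_lt_of_lt_csSup ⟨m, mem_xiMinus_of_le (P := P) hm ha⟩
    (sub_lt_self ξ (by positivity : (0 : ℝ) < 1 / ((n : ℝ) + 1)))
  exact (measureReal_mono fun x (hx : X x < _) => hx.trans hlt).trans hη

/-- Points above the supremum violate the defining inequality; continuity from above passes to the
limit. -/
lemma le_measureReal_le_xiMinus (hX : Measurable X) (hM : ∀ x, X x ≤ M) (ha : a < 1) :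
    a ≤ P.real {x | X x ≤ xiMinus P X a} := by
  set ξ := xiMinus P X a with hξ
  have hset : {x | X x ≤ ξ} = ⋂ n : ℕ, {x | X x < ξ + 1 / ((n : ℝ) + 1)} := by
    ext x
    simp only [Set.mem_ofPred_eq, Set.mem_iInter]
    refine ⟨fun h n => lt_of_le_of_lt h (lt_add_of_pos_right _ (by positivity)), fun h => ?_⟩
    refine ge_of_tendsto' (x := Filter.atTop) (f := fun n : ℕ => ξ + 1 / ((n : ℝ) + 1)) ?_
      fun n => (h n).le
    simpa using (tendsto_one_div_add_atTop_nhds_zero_nat (𝕜 := ℝ)).const_add ξ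
  have hanti : Antitone fun n : ℕ => {x | X x < ξ + 1 / ((n : ℝ) + 1)} := by
    intro n k hnk x (hx : X x < _)
    refine lt_of_lt_of_le hx ?_
    have := Nat.one_div_le_one_div (α := ℝ) hnk
    linarith
  have h1 := tendsto_measure_iInter_atTop (μ := P)
    (fun n => (measurableSet_lt hX measurable_const).nullMeasurableSet) hanti
    ⟨0, measure_ne_top _ _⟩
  rw [← hset] at h1
  have h2 := (ENNReal.tendsto_toReal (measure_ne_top P _)).comp h1
  refine ge_of_tendsto' h2 fun n => ?_
  by_contra! h
  have := le_xiMinus hM ha (le_of_lt h)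
  have : (0 : ℝ) < 1 / ((n : ℝ) + 1) := by positivity
  linarith

end Quantiles

section Plus

variable [IsProbabilityMeasure P] {X : Ω → ℝ} {m M a : ℝ}

lemma xiPlus_le (hm : ∀ x, m ≤ X x) (ha : a < 1) {ξ : ℝ} (h : P.real {x | ξ < X x} ≤ a) :
    xiPlus P X a ≤ ξ := by
  rw [xiPlus_eq_neg, neg_le]
  refine le_xiMinus (M := -m) (fun x => neg_le_neg (hm x)) ha ?_
  simpa only [neg_lt_neg_iff] using h

lemma le_xiPlus (hm : ∀ x, m ≤ X x) (hM : ∀ x, X x ≤ M) (ha : 0 ≤ a) (ha' : a < 1) :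
    m ≤ xiPlus P X a := by
  rw [xiPlus_eq_neg, le_neg]
  exact xiMinus_le (m := -M) (fun x => neg_le_neg (hM x)) (fun x => neg_le_neg (hm x)) ha ha'

lemma measureReal_xiPlus_lt_le (hM : ∀ x, X x ≤ M) (ha : 0 ≤ a) :
    P.real {x | xiPlus P X a < X x} ≤ a := by
  have h := measureReal_lt_xiMinus_le (P := P) (X := fun x => -X x) (m := -M)
    (fun x => neg_le_neg (hM x)) ha
  simpa only [xiPlus_eq_neg, neg_lt] using h

lemma le_measureReal_xiPlus_le (hX : Measurable X) (hm : ∀ x, m ≤ X x) (ha : a < 1) :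
    a ≤ P.real {x | xiPlus P X a ≤ X x} := by
  have h := le_measureReal_le_xiMinus (P := P) (X := fun x => -X x) (M := -m) hX.neg
    (fun x => neg_le_neg (hm x)) ha
  simpa only [xiPlus_eq_neg, neg_le] using h

/-- Otherwise two tails of mass at most `a` would cover the space, impossible for `2a < 1`. The
argument breaks down at `a = 1/2`. -/
lemma xiMinus_le_xiPlus (hm : ∀ x, m ≤ X x) (hM : ∀ x, X x ≤ M) (ha : 0 ≤ a)
    (ha' : a < 1 / 2) : xiMinus P X a ≤ xiPlus P X a := by
  by_contra! h
  have h1 := measureReal_lt_xiMinus_le (P := P) hm ha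
  have h2 := measureReal_xiPlus_lt_le (P := P) hM ha
  have h3 : {x | X x < xiMinus P X a} ∪ {x | xiPlus P X a < X x} = Set.univ :=
    Set.eq_univ_of_forall fun x => (lt_or_ge (X x) (xiMinus P X a)).imp id h.trans_le
  have h4 := measureReal_union_le (μ := P) {x | X x < xiMinus P X a} {x | xiPlus P X a < X x}
  rw [h3, probReal_univ] at h4
  linarith

/-- For a random variable with values in `[m, M]`, `m > 0`, the relative width is at most `1`, and
it is nonnegative for `a < 1 / 2`. -/
lemma relWidth_le_one (hm0 : 0 < m) (hm : ∀ x, m ≤ X x) (hM : ∀ x, X x ≤ M) (ha : 0 ≤ a)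
    (ha' : a < 1) : relWidth P X a ≤ 1 := by
  have h1 := hm0.trans_le (le_xiPlus (P := P) hm hM ha ha')
  have h2 := hm0.trans_le (le_xiMinus (P := P) hM ha' (mem_xiMinus_of_le hm ha))
  have := div_pos h2 h1
  rw [relWidth]
  linarith

lemma relWidth_nonneg (hm0 : 0 < m) (hm : ∀ x, m ≤ X x) (hM : ∀ x, X x ≤ M)
    (ha : 0 ≤ a) (ha' : a < 1 / 2) : 0 ≤ relWidth P X a := by
  have h1 := hm0.trans_le (le_xiPlus (P := P) hm hM ha (by linarith))
  have h2 := (div_le_one h1).2 (xiMinus_le_xiPlus (P := P) hm hM ha ha')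
  rw [relWidth]
  linarith

end Plus

lemma relWidth_congr {X X' : Ω → ℝ} (h : X =ᵐ[P] X') (a : ℝ) :
    relWidth P X a = relWidth P X' a := by
  have h1 (ξ : ℝ) : P.real {x | X x < ξ} = P.real {x | X' x < ξ} :=
    measureReal_congr (h.mono fun x hx => by
      change (X x < ξ) = (X' x < ξ); rw [hx])
  have h2 (ξ : ℝ) : P.real {x | ξ < X x} = P.real {x | ξ < X' x} :=
    measureReal_congr (h.mono fun x hx => by
      change (ξ < X x) = (ξ < X' x); rw [hx])
  simp only [relWidth, xiMinus, xiPlus, h1, h2]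

lemma integrable_log [IsProbabilityMeasure P] {X : Ω → ℝ} {m M : ℝ} (hX : Measurable X)
    (hm0 : 0 < m) (hm : ∀ x, m ≤ X x) (hM : ∀ x, X x ≤ M) :
    Integrable (fun x => Real.log (X x)) P :=
  Integrable.of_mem_Icc (Real.log m) (Real.log M) (Real.measurable_log.comp hX).aemeasurable
    (Filter.Eventually.of_forall fun x =>
      ⟨Real.log_le_log hm0 (hm x), Real.log_le_log (hm0.trans_le (hm x)) (hM x)⟩)

/-- A quantitative form of the concavity of the logarithm at the midpoint. -/
lemma log_midpoint_gap {x y : ℝ} (hx : 0 < x) (hy : 0 < y) :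
    1 / 2 * ((x - y) / (x + y)) ^ 2 ≤
      Real.log ((x + y) / 2) - (Real.log x + Real.log y) / 2 := by
  -- The argument is the squared ratio of geometric to arithmetic mean; its distance from `1` is
  -- `((x - y) / (x + y))²`.
  have h1 := Real.log_le_sub_one_of_pos (x := x * y / ((x + y) / 2) ^ 2) (by positivity)
  rw [Real.log_div (by positivity) (by positivity), Real.log_mul hx.ne' hy.ne',
    Real.log_pow] at h1
  have h2 : 1 - x * y / ((x + y) / 2) ^ 2 = ((x - y) / (x + y)) ^ 2 := by
    field_simp
    ring
  push_cast at h1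
  linarith

/-- With `t = x / y` the right side is `(1 - t) / (1 + t)`, where `t ≤ ξ / η ≤ 1` and `1 + t ≤ 2`.
-/
lemma half_width_le {x y ξ η : ℝ} (hx : 0 < x) (hη : 0 < η) (hxξ : x ≤ ξ) (hy : η ≤ y)
    (h : ξ ≤ η) : (1 - ξ / η) / 2 ≤ (y - x) / (x + y) := by
  have hy0 : 0 < y := hη.trans_le hy
  rw [div_le_div_iff₀ two_pos (by positivity)]
  have h1 : x / y ≤ ξ / η := div_le_div₀ (by linarith) hxξ hη hy
  have h2 : x = x / y * y := (div_mul_cancel₀ x hy0.ne').symm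
  have h3 : 0 < x / y := by positivity
  have h4 : ξ / η ≤ 1 := (div_le_one hη).2 h
  nlinarith

end

/-! ### The Jensen gap of independent copies -/

section

variable {Ω : Type*} [MeasurableSpace Ω] {P : Measure Ω} [IsProbabilityMeasure P]

/-- The Jensen gap of the logarithm for two independent copies of a random variable bounds its
relative width. -/
lemma pair_jensen_gap {X Y : Ω → ℝ} {m M a : ℝ} (hX : Measurable X) (hY : Measurable Y)
    (hind : IndepFun X Y P) (hid : IdentDistrib Y X P P) (hm0 : 0 < m) (hmX : ∀ x, m ≤ X x)
    (hMX : ∀ x, X x ≤ M) (hmY : ∀ x, m ≤ Y x) (hMY : ∀ x, Y x ≤ M) (ha : 0 < a)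
    (ha' : a < 1) (hδ : 0 ≤ relWidth P X a) :
    a ^ 2 * relWidth P X a ^ 2 / 4 ≤
      ∫ x, Real.log ((X x + Y x) / 2) ∂P - ∫ x, Real.log (X x) ∂P := by
  have hiX := integrable_log (P := P) hX hm0 hmX hMX
  have hiY := integrable_log (P := P) hY hm0 hmY hMY
  have hiA : Integrable (fun x => Real.log ((X x + Y x) / 2)) P :=
    integrable_log (m := m) (M := M) ((hX.add hY).div_const 2) hm0
      (fun x => by have := hmX x; have := hmY x; linarith)
      (fun x => by have := hMX x; have := hMY x; linarith)
  have hlogY : ∫ x, Real.log (Y x) ∂P = ∫ x, Real.log (X x) ∂P :=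
    (hid.comp Real.measurable_log).integral_eq
  set g : Ω → ℝ := fun x => Real.log ((X x + Y x) / 2) - (Real.log (X x) + Real.log (Y x)) / 2
  have hg : Integrable g P := hiA.sub ((hiX.add hiY).div_const 2)
  have hgint : ∫ x, g x ∂P =
      ∫ x, Real.log ((X x + Y x) / 2) ∂P - ∫ x, Real.log (X x) ∂P := by
    have hiS : Integrable (fun x => (Real.log (X x) + Real.log (Y x)) / 2) P :=
      (hiX.add hiY).div_const 2
    rw [integral_sub hiA hiS, integral_div, integral_add hiX hiY, hlogY]
    ring
  have hgpos (x : Ω) : 1 / 2 * ((X x - Y x) / (X x + Y x)) ^ 2 ≤ g x :=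
    log_midpoint_gap (hm0.trans_le (hmX x)) (hm0.trans_le (hmY x))
  have hg0 (x : Ω) : 0 ≤ g x := le_trans (by positivity) (hgpos x)
  rw [← hgint]
  set ξ := xiMinus P X a with hξ
  set η := xiPlus P X a with hη
  set δ := relWidth P X a with hδ_def
  have hη0 : 0 < η := hm0.trans_le (le_xiPlus hmX hMX ha.le ha')
  rcases hδ.eq_or_lt with h0 | hpos
  · rw [← h0]
    simpa using integral_nonneg hg0
  have hlt : ξ < η := by
    rw [hδ_def, relWidth, sub_pos, div_lt_one hη0] at hpos
    exact hpos
  -- On `A₁` and its mirror image `A₂` the quantiles separate the copies. Each has probability at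
  -- least `a²` and gap at least `δ²/8`.
  set A₁ : Set Ω := X ⁻¹' Set.Iic ξ ∩ Y ⁻¹' Set.Ici η with hA₁
  set A₂ : Set Ω := X ⁻¹' Set.Ici η ∩ Y ⁻¹' Set.Iic ξ with hA₂
  have hmA₁ : MeasurableSet A₁ := (hX measurableSet_Iic).inter (hY measurableSet_Ici)
  have hmA₂ : MeasurableSet A₂ := (hX measurableSet_Ici).inter (hY measurableSet_Iic)
  have hdis : Disjoint A₁ A₂ := Set.disjoint_left.2 fun x h1 h2 =>
    hlt.not_ge ((show η ≤ X x from h2.1).trans (show X x ≤ ξ from h1.1))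
  have hlow : a ≤ P.real (X ⁻¹' Set.Iic ξ) := le_measureReal_le_xiMinus hX hMX ha'
  have hupp : a ≤ P.real (X ⁻¹' Set.Ici η) := le_measureReal_xiPlus_le hX hmX ha'
  have hY' (s : Set ℝ) (hs : MeasurableSet s) : P.real (Y ⁻¹' s) = P.real (X ⁻¹' s) := by
    rw [measureReal_def, measureReal_def, hid.measure_mem_eq hs]
  have hprod (s t : Set ℝ) (hs : MeasurableSet s) (ht : MeasurableSet t) :
      P.real (X ⁻¹' s ∩ Y ⁻¹' t) = P.real (X ⁻¹' s) * P.real (X ⁻¹' t) := by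
    rw [← hY' t ht, measureReal_def, hind.measure_inter_preimage_eq_mul _ _ hs ht,
      ENNReal.toReal_mul]
    rfl
  have hP : 2 * a ^ 2 ≤ P.real (A₁ ∪ A₂) := by
    rw [measureReal_union hdis hmA₂, hA₁, hA₂, hprod _ _ measurableSet_Iic measurableSet_Ici,
      hprod _ _ measurableSet_Ici measurableSet_Iic]
    have := mul_le_mul hlow hupp ha.le (ha.le.trans hlow)
    linarith
  have hind_le (x : Ω) : (A₁ ∪ A₂).indicator (fun _ => δ ^ 2 / 8) x ≤ g x := by
    refine Set.indicator_le' (fun x hx => ?_) (fun x _ => hg0 x) x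
    have key : δ / 2 ≤ |(X x - Y x) / (X x + Y x)| := by
      rcases hx with hx | hx
      · refine (half_width_le (hm0.trans_le (hmX x)) hη0 hx.1 hx.2 hlt.le).trans ?_
        rw [← abs_neg, ← neg_div, neg_sub]
        exact le_abs_self _
      · refine (half_width_le (hm0.trans_le (hmY x)) hη0 hx.2 hx.1 hlt.le).trans ?_
        rw [add_comm (Y x)]
        exact le_abs_self _
    have h2 := pow_le_pow_left₀ (by positivity) key 2
    rw [sq_abs] at h2
    have := hgpos x
    linarith
  have h1 := integral_mono ((integrable_const (δ ^ 2 / 8)).indicator (hmA₁.union hmA₂)) hg hind_le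
  rw [integral_indicator_const _ (hmA₁.union hmA₂), smul_eq_mul] at h1
  have h2 := mul_le_mul_of_nonneg_right hP (by positivity : 0 ≤ δ ^ 2 / 8)
  linarith

/-- The Jensen gap for `n + 2` pairwise independent copies. -/
lemma jensen_gap {n : ℕ} {X : Ω → ℝ} {Y : Fin (n + 2) → Ω → ℝ} {m M a : ℝ}
    (hY : ∀ j, Measurable (Y j)) (hind : ∀ i j, i ≠ j → IndepFun (Y i) (Y j) P)
    (hid : ∀ j, IdentDistrib (Y j) X P P) (hm0 : 0 < m) (hmY : ∀ j x, m ≤ Y j x) (hMY : ∀ j x, Y j x ≤ M) (ha : 0 < a)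
    (ha' : a < 1) (hδ : 0 ≤ relWidth P X a) :
    a ^ 2 * relWidth P X a ^ 2 / 4 ≤
      ∫ x, Real.log (((n + 2 : ℕ) : ℝ)⁻¹ * ∑ j, Y j x) ∂P - ∫ x, Real.log (X x) ∂P := by
  have hrel (j : Fin (n + 2)) : relWidth P (Y j) a = relWidth P X a := by
    have h1 (ξ : ℝ) : P.real {x | Y j x < ξ} = P.real {x | X x < ξ} := by
      rw [measureReal_def, measureReal_def]
      exact congrArg _ ((hid j).measure_mem_eq measurableSet_Iio)
    have h2 (ξ : ℝ) : P.real {x | ξ < Y j x} = P.real {x | ξ < X x} := by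
      rw [measureReal_def, measureReal_def]
      exact congrArg _ ((hid j).measure_mem_eq measurableSet_Ioi)
    simp only [relWidth, xiMinus, xiPlus, h1, h2]
  -- Addition is cyclic; with at least two copies, cyclic neighbours are distinct and hence
  -- independent.
  have hne (j : Fin (n + 2)) : j ≠ j + 1 := by simp
  have hint (j : Fin (n + 2)) : ∫ x, Real.log (Y j x) ∂P = ∫ x, Real.log (X x) ∂P :=
    ((hid j).comp Real.measurable_log).integral_eq
  have hpair (j : Fin (n + 2)) := pair_jensen_gap (hY j) (hY (j + 1)) (hind _ _ (hne j))
    ((hid (j + 1)).trans (hid j).symm) hm0 (hmY j) (hMY j) (hmY (j + 1)) (hMY (j + 1)) ha ha'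
    ((hrel j).symm ▸ hδ)
  simp only [hrel, hint] at hpair
  have hc : (0 : ℝ) < ((n + 2 : ℕ) : ℝ) := by positivity
  have hiP (j : Fin (n + 2)) : Integrable (fun x => Real.log ((Y j x + Y (j + 1) x) / 2)) P :=
    integrable_log (m := m) (M := M) (((hY j).add (hY (j + 1))).div_const 2) hm0
      (fun x => by
        have := hmY j x; have := hmY (j + 1) x; linarith)
      (fun x => by
        have := hMY j x; have := hMY (j + 1) x; linarith)
  have hiS : Integrable (fun x => Real.log (((n + 2 : ℕ) : ℝ)⁻¹ * ∑ j, Y j x)) P := by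
    refine integrable_log (m := m) (M := M)
      ((Finset.measurable_fun_sum _ fun j _ => hY j).const_mul _) hm0 (fun x => ?_) (fun x => ?_)
    · rw [inv_mul_eq_div, le_div_iff₀ hc]
      simpa [mul_comm] using Finset.card_nsmul_le_sum Finset.univ (fun j => Y j x) m
        fun j _ => hmY j x
    · rw [inv_mul_eq_div, div_le_iff₀ hc]
      simpa [mul_comm] using Finset.sum_le_card_nsmul Finset.univ (fun j => Y j x) M
        fun j _ => hMY j x
  -- The mean of the copies is the mean of the averages of cyclic neighbours, so concavity reduces
  -- the gap to that of pairs.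
  have hconc (x : Ω) : ∑ j, ((n + 2 : ℕ) : ℝ)⁻¹ * Real.log ((Y j x + Y (j + 1) x) / 2) ≤
      Real.log (((n + 2 : ℕ) : ℝ)⁻¹ * ∑ j, Y j x) := by
    have h := strictConcaveOn_log_Ioi.concaveOn.le_map_sum (t := Finset.univ)
      (w := fun _ : Fin (n + 2) => ((n + 2 : ℕ) : ℝ)⁻¹)
      (p := fun j => (Y j x + Y (j + 1) x) / 2) (fun _ _ => by positivity)
      (by rw [Finset.sum_const, Finset.card_univ, Fintype.card_fin, nsmul_eq_mul,
            mul_inv_cancel₀ hc.ne'])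
      (fun j _ => by
        have := hmY j x; have := hmY (j + 1) x
        exact Set.mem_Ioi.2 (by linarith))
    simp only [smul_eq_mul] at h
    refine h.trans_eq ?_
    have hshift : ∑ j, Y (j + 1) x = ∑ j, Y j x :=
      Equiv.sum_comp (Equiv.addRight (1 : Fin (n + 2))) fun j => Y j x
    rw [← Finset.mul_sum, ← Finset.sum_div, Finset.sum_add_distrib, hshift]
    congr 2
    ring
  have h1 := integral_mono (integrable_finsetSum Finset.univ fun j _ => (hiP j).const_mul _)
    hiS hconc
  rw [integral_finsetSum _ fun j _ => (hiP j).const_mul _] at h1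
  simp only [integral_const_mul] at h1
  rw [← Finset.mul_sum] at h1
  have h2 := Finset.sum_le_sum fun j (_ : j ∈ Finset.univ) => hpair j
  rw [Finset.sum_sub_distrib, Finset.sum_const, Finset.sum_const, Finset.card_univ,
    Fintype.card_fin, nsmul_eq_mul, nsmul_eq_mul] at h2
  have h3 := mul_le_mul_of_nonneg_left h2 (inv_nonneg.2 hc.le)
  rw [mul_sub, inv_mul_cancel_left₀ hc.ne', inv_mul_cancel_left₀ hc.ne'] at h3
  linarith

end

/-! ### Width bounds from the abstract recursion -/

section

variable {Ω : Type*} [MeasurableSpace Ω] {P : Measure Ω}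

/-- `X` is the imaginary part of the Weyl-Titchmarsh function at the root, `Y j` are those at the
next edges, and `Q` is the squared modulus of the ratio of the values of the solution. -/
structure IsTreeRecursion (P : Measure Ω) (n : ℕ) (X : Ω → ℝ) (Y : Fin (n + 2) → Ω → ℝ)
    (Q : Ω → ℝ) (m M : ℝ) : Prop where
  measX : Measurable X
  measY : ∀ j, Measurable (Y j)
  measQ : Measurable Q
  indep : ∀ i j, i ≠ j → IndepFun (Y i) (Y j) P
  ident : ∀ j, IdentDistrib (Y j) X P P
  pos : 0 < m
  le_X : ∀ x, m ≤ X x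
  X_le : ∀ x, X x ≤ M
  le_Y : ∀ j x, m ≤ Y j x
  Y_le : ∀ j x, Y j x ≤ M
  le_Q : ∀ x, m ≤ Q x
  Q_le : ∀ x, Q x ≤ M
  recursion : ∀ x, Q x * ∑ j, Y j x ≤ X x

namespace IsTreeRecursion

variable {n : ℕ} {X : Ω → ℝ} {Y : Fin (n + 2) → Ω → ℝ} {Q : Ω → ℝ} {m M a : ℝ}

/-- The logarithmic loss of current along the root edge. -/
def loss (X : Ω → ℝ) (Y : Fin (n + 2) → Ω → ℝ) (Q : Ω → ℝ) (x : Ω) : ℝ :=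
  Real.log (X x) - (Real.log (Q x) + Real.log (∑ j, Y j x))

/-- The Lyapunov exponent of the recursion. -/
def exponent (P : Measure Ω) (n : ℕ) (Q : Ω → ℝ) : ℝ :=
  -∫ x, Real.log (√((n + 2 : ℕ) : ℝ) * √(Q x)) ∂P

section

variable (h : IsTreeRecursion P n X Y Q m M)
include h

lemma sum_pos (x : Ω) : 0 < ∑ j, Y j x :=
  Finset.sum_pos (fun j _ => h.pos.trans_le (h.le_Y j x)) Finset.univ_nonempty

lemma Q_pos (x : Ω) : 0 < Q x := h.pos.trans_le (h.le_Q x)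

lemma X_pos (x : Ω) : 0 < X x := h.pos.trans_le (h.le_X x)

lemma loss_nonneg (x : Ω) : 0 ≤ loss X Y Q x := by
  rw [loss, ← Real.log_mul (h.Q_pos x).ne' (h.sum_pos x).ne', sub_nonneg]
  exact Real.log_le_log (mul_pos (h.Q_pos x) (h.sum_pos x)) (h.recursion x)

lemma log_ratio_eq (x : Ω) : Real.log (√((n + 2 : ℕ) : ℝ) * √(Q x)) =
    (Real.log ((n + 2 : ℕ) : ℝ) + Real.log (Q x)) / 2 := by
  have h1 : (0 : ℝ) < ((n + 2 : ℕ) : ℝ) := by positivity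
  rw [← Real.sqrt_mul h1.le, Real.log_sqrt (mul_pos h1 (h.Q_pos x)).le,
    Real.log_mul h1.ne' (h.Q_pos x).ne']

lemma measureReal_Y_lt (j : Fin (n + 2)) (ξ : ℝ) :
    P.real {x | Y j x < ξ} = P.real {x | X x < ξ} := by
  rw [measureReal_def, measureReal_def]
  exact congrArg _ ((h.ident j).measure_mem_eq measurableSet_Iio)

lemma measureReal_lt_Y (j : Fin (n + 2)) (ξ : ℝ) :
    P.real {x | ξ < Y j x} = P.real {x | ξ < X x} := by
  rw [measureReal_def, measureReal_def]
  exact congrArg _ ((h.ident j).measure_mem_eq measurableSet_Ioi)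

variable [IsProbabilityMeasure P]

lemma integrable_log_Q : Integrable (fun x => Real.log (Q x)) P :=
  integrable_log h.measQ h.pos h.le_Q h.Q_le

lemma integrable_log_X : Integrable (fun x => Real.log (X x)) P :=
  integrable_log h.measX h.pos h.le_X h.X_le

lemma integrable_log_sum : Integrable (fun x => Real.log (∑ j, Y j x)) P := by
  refine integrable_log (m := ∑ _j : Fin (n + 2), m) (M := ∑ _j : Fin (n + 2), M)
    (Finset.measurable_fun_sum _ fun j _ => h.measY j)
    (Finset.sum_pos (fun _ _ => h.pos) Finset.univ_nonempty) (fun x => ?_) (fun x => ?_)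
  · exact Finset.sum_le_sum fun j _ => h.le_Y j x
  · exact Finset.sum_le_sum fun j _ => h.Y_le j x

lemma integrable_log_ratio :
    Integrable (fun x => Real.log (√((n + 2 : ℕ) : ℝ) * √(Q x))) P := by
  simp only [h.log_ratio_eq]
  exact ((integrable_const _).add h.integrable_log_Q).div_const 2

lemma integrable_loss : Integrable (loss X Y Q) P :=
  h.integrable_log_X.sub (h.integrable_log_Q.add h.integrable_log_sum)

/-- Twice the Lyapunov exponent is the mean loss plus the Jensen gap. -/
lemma two_mul_exponent : 2 * exponent P n Q = ∫ x, loss X Y Q x ∂P +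
    (∫ x, Real.log (((n + 2 : ℕ) : ℝ)⁻¹ * ∑ j, Y j x) ∂P - ∫ x, Real.log (X x) ∂P) := by
  have h1 : (0 : ℝ) < ((n + 2 : ℕ) : ℝ) := by positivity
  have hS : ∫ x, Real.log (((n + 2 : ℕ) : ℝ)⁻¹ * ∑ j, Y j x) ∂P =
      -Real.log ((n + 2 : ℕ) : ℝ) + ∫ x, Real.log (∑ j, Y j x) ∂P := by
    have (x : Ω) : Real.log (((n + 2 : ℕ) : ℝ)⁻¹ * ∑ j, Y j x) =
        -Real.log ((n + 2 : ℕ) : ℝ) + Real.log (∑ j, Y j x) := by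
      rw [Real.log_mul (inv_ne_zero h1.ne') (h.sum_pos x).ne', Real.log_inv]
    simp only [this]
    rw [integral_add (integrable_const _) h.integrable_log_sum]
    simp
  have hD : ∫ x, loss X Y Q x ∂P = ∫ x, Real.log (X x) ∂P -
      (∫ x, Real.log (Q x) ∂P + ∫ x, Real.log (∑ j, Y j x) ∂P) := by
    rw [← integral_add h.integrable_log_Q h.integrable_log_sum]
    exact integral_sub h.integrable_log_X (h.integrable_log_Q.add h.integrable_log_sum)
  have hE : exponent P n Q =
      -((Real.log ((n + 2 : ℕ) : ℝ) + ∫ x, Real.log (Q x) ∂P) / 2) := by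
    rw [exponent]
    simp only [h.log_ratio_eq]
    rw [integral_div, integral_add (integrable_const _) h.integrable_log_Q]
    simp
  rw [hS, hD, hE]
  ring

lemma integral_loss_add_gap_le (ha : 0 < a) (ha' : a < 1) (hδ : 0 ≤ relWidth P X a) :
    ∫ x, loss X Y Q x ∂P + a ^ 2 * relWidth P X a ^ 2 / 4 ≤ 2 * exponent P n Q := by
  rw [h.two_mul_exponent]
  have := jensen_gap h.measY h.indep h.ident h.pos h.le_Y h.Y_le ha ha' hδ
  linarith

lemma relWidth_X_sq_le (ha : 0 < a) (ha' : a < 1) (hδ : 0 ≤ relWidth P X a) :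
    relWidth P X a ^ 2 ≤ 8 / a ^ 2 * exponent P n Q := by
  have h1 := h.integral_loss_add_gap_le ha ha' hδ
  have h2 := integral_nonneg (μ := P) (f := loss X Y Q) h.loss_nonneg
  rw [div_mul_eq_mul_div, le_div_iff₀ (by positivity)]
  linarith

lemma integral_loss_le : ∫ x, loss X Y Q x ∂P ≤ 2 * exponent P n Q := by
  -- Any level below `1/2` would do, since only the sign of the gap is used.
  have h1 := h.integral_loss_add_gap_le (a := 1 / 4) (by norm_num) (by norm_num)
    (relWidth_nonneg h.pos h.le_X h.X_le (by norm_num) (by norm_num))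
  have : 0 ≤ (1 / 4 : ℝ) ^ 2 * relWidth P X (1 / 4) ^ 2 / 4 := by positivity
  linarith

lemma exponent_nonneg : 0 ≤ exponent P n Q := by
  have := h.integral_loss_le
  have := integral_nonneg (μ := P) (f := loss X Y Q) h.loss_nonneg
  linarith

lemma xiMinus_X_pos (ha : 0 ≤ a) (ha' : a < 1) : 0 < xiMinus P X a :=
  h.pos.trans_le (le_xiMinus h.X_le ha' (mem_xiMinus_of_le h.le_X ha))

lemma xiPlus_X_pos (ha : 0 ≤ a) (ha' : a < 1) : 0 < xiPlus P X a :=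
  h.pos.trans_le (le_xiPlus h.le_X h.X_le ha ha')

/-- The recursion gives `Q ≤ X / ∑ Y j`. The union bound runs over `n + 3` quantile events, one for
`X` and `n + 2` for the `Y j`. -/
lemma xiPlus_Q_le {b : ℝ} (hb : 0 < b) (hb' : b < 1) (hba : ((n : ℝ) + 3) * b ≤ a)
    (ha' : a < 1) :
    xiPlus P Q a ≤ xiPlus P X b / (((n : ℝ) + 2) * xiMinus P X b) := by
  have h1 := h.xiMinus_X_pos hb.le hb'
  have h2 := h.xiPlus_X_pos hb.le hb'
  refine xiPlus_le h.le_Q ha' (le_trans ?_ hba)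
  have hsub : {x | xiPlus P X b / (((n : ℝ) + 2) * xiMinus P X b) < Q x} ⊆
      {x | xiPlus P X b < X x} ∪ ⋃ j, {x | Y j x < xiMinus P X b} := by
    intro x (hx : _ < Q x)
    by_contra hcon
    simp only [Set.mem_union, Set.mem_iUnion, Set.mem_ofPred_eq, not_or, not_exists,
      not_lt] at hcon
    have h3 : ((n : ℝ) + 2) * xiMinus P X b ≤ ∑ j, Y j x := by
      simpa using Finset.card_nsmul_le_sum Finset.univ (fun j => Y j x) _ fun j _ => hcon.2 j
    rw [div_lt_iff₀ (by positivity)] at hx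
    have h4 := mul_le_mul_of_nonneg_left h3 (h.Q_pos x).le
    linarith [h.recursion x, hcon.1]
  refine (measureReal_mono hsub).trans ((measureReal_union_le _ _).trans ?_)
  have h5 : P.real (⋃ j, {x | Y j x < xiMinus P X b}) ≤ ((n : ℝ) + 2) * b := by
    refine (measureReal_iUnion_fintype_le _).trans ?_
    simp only [h.measureReal_Y_lt]
    have := measureReal_lt_xiMinus_le (P := P) h.le_X hb.le
    rw [Finset.sum_const, Finset.card_univ, Fintype.card_fin, nsmul_eq_mul]
    push_cast
    gcongr
  have h6 := measureReal_xiPlus_lt_le (P := P) h.X_le hb.le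
  linarith

/-- Where the loss is below `d`, the recursion is reversed at the cost of a factor `exp (-d)`. Half
of `a` pays for the quantile events, half for Markov's inequality applied to the loss, whose mean is
at most twice the exponent. -/
lemma le_xiMinus_Q {b d : ℝ} (hb : 0 < b) (hb' : b < 1) (ha : 0 < a)
    (hba : ((n : ℝ) + 3) * b ≤ a / 2) (ha' : a < 1) (hd : 4 * exponent P n Q / a < d) :
    Real.exp (-d) * (xiMinus P X b / (((n : ℝ) + 2) * xiPlus P X b)) ≤ xiMinus P Q a := by
  have h1 := h.xiMinus_X_pos hb.le hb'
  have h2 := h.xiPlus_X_pos hb.le hb'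
  have hd0 : 0 < d := lt_of_le_of_lt (by have := h.exponent_nonneg; positivity) hd
  refine le_xiMinus h.Q_le ha' ?_
  have hsub : {x | Q x < Real.exp (-d) * (xiMinus P X b / (((n : ℝ) + 2) * xiPlus P X b))} ⊆
      ({x | X x < xiMinus P X b} ∪ ⋃ j, {x | xiPlus P X b < Y j x}) ∪
        {x | d ≤ loss X Y Q x} := by
    intro x (hx : Q x < _)
    by_contra hcon
    simp only [Set.mem_union, Set.mem_iUnion, Set.mem_ofPred_eq, not_or, not_exists,
      not_lt, not_le] at hcon
    obtain ⟨⟨h3, h4⟩, h5⟩ := hcon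
    have h6 : ∑ j, Y j x ≤ ((n : ℝ) + 2) * xiPlus P X b := by
      simpa using Finset.sum_le_card_nsmul Finset.univ (fun j => Y j x) _ fun j _ => h4 j
    have h7 : Real.exp (-d) * X x ≤ Q x * ∑ j, Y j x := by
      rw [← Real.log_le_log_iff (mul_pos (Real.exp_pos _) (h.X_pos x))
        (mul_pos (h.Q_pos x) (h.sum_pos x)), Real.log_mul (Real.exp_pos _).ne' (h.X_pos x).ne',
        Real.log_exp, Real.log_mul (h.Q_pos x).ne' (h.sum_pos x).ne']
      rw [loss] at h5
      linarith
    rw [← mul_div_assoc, lt_div_iff₀ (by positivity)] at hx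
    have h8 := mul_le_mul_of_nonneg_left h6 (h.Q_pos x).le
    have h9 := mul_le_mul_of_nonneg_left h3 (Real.exp_pos (-d)).le
    linarith
  refine (measureReal_mono hsub).trans ((measureReal_union_le _ _).trans ?_)
  have h5 : P.real (⋃ j, {x | xiPlus P X b < Y j x}) ≤ ((n : ℝ) + 2) * b := by
    refine (measureReal_iUnion_fintype_le _).trans ?_
    simp only [h.measureReal_lt_Y]
    have := measureReal_xiPlus_lt_le (P := P) h.X_le hb.le
    rw [Finset.sum_const, Finset.card_univ, Fintype.card_fin, nsmul_eq_mul]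
    push_cast
    gcongr
  have h6 := measureReal_lt_xiMinus_le (P := P) h.le_X hb.le
  have h7 : P.real {x | d ≤ loss X Y Q x} ≤ a / 2 := by
    have h8 := mul_meas_ge_le_integral_of_nonneg (μ := P)
      (Filter.Eventually.of_forall h.loss_nonneg) h.integrable_loss d
    have h9 := h.integral_loss_le
    rw [div_lt_iff₀ ha] at hd
    by_contra! h10
    have := mul_lt_mul_of_pos_left h10 hd0
    linarith
  have h8 := measureReal_union_le (μ := P) {x | X x < xiMinus P X b}
    (⋃ j, {x | xiPlus P X b < Y j x})
  linarith

lemma relWidth_Q_le {b : ℝ} (hb : 0 < b) (hb' : b < 1 / 2) (ha : 0 < a)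
    (hba : ((n : ℝ) + 3) * b ≤ a / 2) (ha' : a < 1) :
    relWidth P Q a ≤ 2 * relWidth P X b + 4 * exponent P n Q / a := by
  rw [← sub_le_iff_le_add']
  -- A strictly larger `d` keeps Markov's inequality useful when the exponent is zero.
  refine le_of_forall_gt_imp_ge_of_dense fun d hd => ?_
  have hb1 : b < 1 := by linarith
  have h1 := h.xiMinus_X_pos hb.le hb1
  have h2 := h.xiPlus_X_pos hb.le hb1
  have hd0 : 0 < d := lt_of_le_of_lt (by have := h.exponent_nonneg; positivity) hd
  have hδ0 := relWidth_nonneg (P := P) h.pos h.le_X h.X_le hb.le hb'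
  have hδ1 := relWidth_le_one (P := P) h.pos h.le_X h.X_le hb.le hb1
  have h3 := h.le_xiMinus_Q hb hb1 ha hba ha' hd
  have h4 := h.xiPlus_Q_le hb hb1 (by linarith) ha'
  have h5 : 0 < xiPlus P Q a := h.pos.trans_le (le_xiPlus h.le_Q h.Q_le ha.le ha')
  set q := xiMinus P X b / xiPlus P X b with hq
  have hq1 : relWidth P X b = 1 - q := rfl
  -- The width bound then follows from `exp (-d) ≥ 1 - d`, `q² ≤ 1` and `1 - q² ≤ 2 (1 - q)`.
  have h6 : Real.exp (-d) * q ^ 2 ≤ xiMinus P Q a / xiPlus P Q a := by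
    refine le_trans (le_of_eq ?_) (div_le_div₀ (le_trans (by positivity) h3) h3 h5 h4)
    rw [hq]
    field_simp
  have h7 := Real.add_one_le_exp (-d)
  have h8 := mul_le_mul_of_nonneg_right h7 (sq_nonneg q)
  rw [hq1] at hδ0 hδ1 ⊢
  have h9 : q ^ 2 ≤ 1 := by nlinarith
  have h10 := mul_le_mul_of_nonneg_left h9 hd0.le
  have h11 := sq_nonneg (1 - q)
  rw [relWidth]
  linarith

lemma relWidth_Q_sq_le (ha : 0 < a) (ha' : a < 1) (hδ : 0 ≤ relWidth P Q a) :
    relWidth P Q a ^ 2 ≤ 512 * (((n : ℝ) + 3) ^ 2 / a ^ 2) * exponent P n Q := by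
  have hγ := h.exponent_nonneg
  set γ := exponent P n Q with hγ_def
  have hδ1 := relWidth_le_one (P := P) h.pos h.le_Q h.Q_le ha.le ha'
  have hn : (0 : ℝ) ≤ n := Nat.cast_nonneg n
  set N : ℝ := (n : ℝ) + 3
  have hN : 3 ≤ N := by simp only [N]; linarith
  rw [← mul_div_assoc, div_mul_eq_mul_div, le_div_iff₀ (by positivity)]
  -- For large `γ` the bound is trivial, as the width is at most `1`. Otherwise `γ ≤ 1`, so `γ²` can
  -- be absorbed into `γ`.
  rcases le_total (a ^ 2) (512 * N ^ 2 * γ) with hbig | hsmall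
  · refine le_trans ?_ hbig
    have := pow_le_one₀ (n := 2) hδ hδ1
    nlinarith [sq_nonneg a]
  set b := a / (2 * N) with hb_def
  have hb : 0 < b := by positivity
  have hNb : N * b = a / 2 := by rw [hb_def]; field_simp
  have hb' : b < 1 / 2 := by nlinarith
  have hδb := relWidth_nonneg (P := P) h.pos h.le_X h.X_le hb.le hb'
  have h1 := h.relWidth_Q_le hb hb' ha hNb.le ha'
  have h2 := h.relWidth_X_sq_le hb (by linarith) hδb
  rw [div_mul_eq_mul_div, le_div_iff₀ (by positivity)] at h2
  rw [← hγ_def] at h1 h2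
  have h3 : a * relWidth P Q a ≤ 4 * N * (b * relWidth P X b) + 4 * γ := by
    have := mul_le_mul_of_nonneg_left h1 ha.le
    rw [mul_add, mul_div_cancel₀ _ ha.ne'] at this
    have h4 : a = 2 * (N * b) := by rw [hNb]; ring
    calc a * relWidth P Q a ≤ a * (2 * relWidth P X b) + 4 * γ := this
      _ = 4 * N * (b * relWidth P X b) + 4 * γ := by rw [h4]; ring
  set t := b * relWidth P X b with ht_def
  have ht : t ^ 2 ≤ 8 * γ := by rw [ht_def, mul_pow]; linarith
  have ht0 : 0 ≤ t := by positivity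
  have h5 : (a * relWidth P Q a) ^ 2 ≤ (4 * N * t + 4 * γ) ^ 2 :=
    pow_le_pow_left₀ (by positivity) h3 2
  -- Each of the two terms is at most `256 N² γ`, whence the constant `512`.
  have h6 : (4 * N * t + 4 * γ) ^ 2 ≤ 32 * N ^ 2 * t ^ 2 + 32 * γ ^ 2 := by
    nlinarith [sq_nonneg (4 * N * t - 4 * γ)]
  have h7 : 32 * N ^ 2 * t ^ 2 ≤ 256 * N ^ 2 * γ := by
    have := mul_le_mul_of_nonneg_left ht (by positivity : 0 ≤ 32 * N ^ 2)
    linarith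
  have hN2 : 9 ≤ N ^ 2 := by nlinarith
  have h8 : γ ≤ 1 := by nlinarith
  have h9 : γ ^ 2 ≤ γ := by nlinarith
  have h10 : 32 * γ ≤ 256 * N ^ 2 * γ := by nlinarith
  calc relWidth P Q a ^ 2 * a ^ 2 = (a * relWidth P Q a) ^ 2 := by ring
    _ ≤ 512 * N ^ 2 * γ := by linarith

end

end IsTreeRecursion

end

/-! ### The random tree satisfies the recursion -/

section

/-- Restriction of the potential to `[-M, M]`. -/
def clamp (M t : ℝ) : ℝ := max (-M) (min M t)

lemma abs_clamp_le {M : ℝ} (hM : 0 ≤ M) (t : ℝ) : |clamp M t| ≤ M :=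
  abs_le.2 ⟨le_max_left _ _, max_le (by linarith) (min_le_left _ _)⟩

lemma clamp_of_abs_le {M t : ℝ} (h : |t| ≤ M) : clamp M t = t := by
  rw [clamp, min_eq_right (abs_le.1 h).2, max_eq_right (abs_le.1 h).1]

/-- The edge lengths of the deformed tree with clamped potential. -/
def clampedLength {K : ℕ} (L lam M : ℝ) (w : Edge K → ℝ) : Edge K → ℝ :=
  deformedLength L lam fun e => clamp M (w e)

lemma continuous_clampedLength {K : ℕ} (L lam M : ℝ) :
    Continuous (clampedLength (K := K) L lam M) := by
  unfold clampedLength deformedLength clamp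
  fun_prop

lemma clampedLength_mem {K : ℕ} {L M : ℝ} (hL : 0 < L) (hM : 0 ≤ M) (lam : ℝ) (w : Edge K → ℝ)
    (e : Edge K) : clampedLength L lam M w e ∈
      Set.Icc (L * Real.exp (-(|lam| * M))) (L * Real.exp (|lam| * M)) := by
  have h : |lam * clamp M (w e)| ≤ |lam| * M := by
    rw [abs_mul]
    exact mul_le_mul_of_nonneg_left (abs_clamp_le hM _) (abs_nonneg _)
  obtain ⟨h1, h2⟩ := abs_le.1 h
  exact ⟨mul_le_mul_of_nonneg_left (Real.exp_le_exp.2 h1) hL.le,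
    mul_le_mul_of_nonneg_left (Real.exp_le_exp.2 h2) hL.le⟩

lemma exists_sol_bound (z : ℂ) (C l₀ l₁ : ℝ) : ∃ S > 0, ∀ r : ℂ, ‖r‖ ≤ C → ∀ l ∈ Set.Icc l₀ l₁,
    ‖sol z 1 r l‖ ≤ S := by
  obtain ⟨S, hS⟩ := ((isCompact_closedBall (0 : ℂ) C).prod
    (isCompact_Icc (a := l₀) (b := l₁))).exists_bound_of_continuousOn
    (continuous_sol_pair (z := z)).continuousOn
  exact ⟨max S 1, by positivity, fun r hr l hl =>
    (hS (r, l) ⟨by simpa using hr, hl⟩).trans (le_max_left _ _)⟩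

/-- The same solution traversed backwards starts with logarithmic derivative `-W` and has the
inverse growth factor. An upper bound on growth thus yields a lower one. -/
lemma sol_mul_sol_neg {z : ℂ} (hz : 0 < z.im) {W r : ℂ} {l : ℝ}
    (h : W * sol z 1 r l = dsol z 1 r l) : sol z 1 r l * sol z 1 (-W) l = 1 := by
  have hcs := cosSol_sq_add hz l
  unfold sol dsol at *
  linear_combination hcs - sinSol z l * h

variable {Ω : Type*} [MeasurableSpace Ω] {P : Measure Ω}

/-- The last letter of a word is its first step from the root, so the two subtrees share no edge. -/
lemma indepFun_subtrees {K : ℕ} {w : Edge K → Ω → ℝ} (hmeas : ∀ e, Measurable (w e))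
    (hindep : iIndepFun w P) {i j : Fin K} (hij : i ≠ j) :
    IndepFun (fun x e => w (e ++ [i]) x) (fun x e => w (e ++ [j]) x) P := by
  have hdis : Disjoint (Set.range fun e : Edge K => e ++ [i])
      (Set.range fun e : Edge K => e ++ [j]) := by
    refine Set.disjoint_left.2 ?_
    rintro _ ⟨e, rfl⟩ ⟨f, hf⟩
    exact hij (by simpa using (List.append_inj' hf rfl).2.symm)
  have h := indep_iSup_of_disjoint (fun e => (hmeas e).comap_le) hindep.iIndep hdis
  rw [IndepFun_iff_Indep]
  have hle (k : Fin K) : MeasurableSpace.comap (fun x (e : Edge K) => w (e ++ [k]) x)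
      MeasurableSpace.pi ≤ ⨆ e ∈ Set.range fun e : Edge K => e ++ [k],
        MeasurableSpace.comap (w e) inferInstance := by
    rw [MeasurableSpace.pi, MeasurableSpace.comap_iSup]
    refine iSup_le fun e => ?_
    rw [MeasurableSpace.comap_comp]
    exact le_iSup₂_of_le (e ++ [k]) ⟨e, rfl⟩ le_rfl
  exact indep_of_indep_of_le_left (indep_of_indep_of_le_right h (hle j)) (hle i)

lemma identDistrib_subtree {K : ℕ} {w : Edge K → Ω → ℝ} (hindep : iIndepFun w P)
    (hident : ∀ e f, IdentDistrib (w e) (w f) P P) (j : Fin K) :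
    IdentDistrib (fun x e => w (e ++ [j]) x) (fun x e => w e x) P P :=
  IdentDistrib.pi (fun e => hident (e ++ [j]) e)
    (hindep.precomp (g := fun e : Edge K => e ++ [j]) (List.append_left_injective [j])) hindep

/-- The Weyl-Titchmarsh functions of the random tree satisfy the assumptions on which the bounds of
the relative widths are based. -/
lemma exists_isTreeRecursion {n : ℕ} {L : ℝ} (hL : 0 < L) {w : Edge (n + 2) → Ω → ℝ}
    (hmeas : ∀ e, Measurable (w e)) (hindep : iIndepFun w P)
    (hident : ∀ e f, IdentDistrib (w e) (w f) P P) (hbdd : ∃ M : ℝ, ∀ e, ∀ᵐ x ∂P, |w e x| ≤ M)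
    (lam : ℝ) {z : ℂ} (hz : 0 < z.im) (j : Fin (n + 2)) :
    ∃ X Y Q m M, IsTreeRecursion P n X Y Q m M ∧ imR w L lam z =ᵐ[P] X ∧
      modSq w L lam z =ᵐ[P] Q ∧
      logRatio w L lam z j =ᵐ[P] fun x => Real.log (√((n + 2 : ℕ) : ℝ) * √(Q x)) := by
  obtain ⟨M₀, hM₀⟩ := hbdd
  set A := |M₀|
  have hA : 0 ≤ A := abs_nonneg _
  set l₀ := L * Real.exp (-(|lam| * A))
  have hl₀ : 0 < l₀ := by positivity
  set l₁ := L * Real.exp (|lam| * A)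
  obtain ⟨κ, hκ, hco⟩ := exists_coercive_of_le hz hl₀
  set C := (z.im * κ)⁻¹
  have hC : 0 < C := by positivity
  -- The radius also covers the sum of the `n + 2` forward logarithmic derivatives, needed for the
  -- lower bound on `q`.
  obtain ⟨S, hS0, hS⟩ := exists_sol_bound z (((n + 2 : ℕ) : ℝ) * C) l₀ l₁
  have hCle : C ≤ ((n + 2 : ℕ) : ℝ) * C := by
    refine le_mul_of_one_le_left hC.le ?_
    push_cast
    linarith [(Nat.cast_nonneg n : (0 : ℝ) ≤ n)]
  -- Clamping makes the length bounds hold for every configuration, so that `Φ` is continuous on the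
  -- whole product space.
  set ℓ : (Edge (n + 2) → ℝ) → Edge (n + 2) → ℝ := clampedLength L lam A
  have hℓ (v : Edge (n + 2) → ℝ) (e : Edge (n + 2)) : ℓ v e ∈ Set.Icc l₀ l₁ :=
    clampedLength_mem hL hA lam v e
  have hprop (v : Edge (n + 2) → ℝ) := RPlus_properties hz hl₀ hκ hco fun e => (hℓ v e).1
  set Φ : (Edge (n + 2) → ℝ) → ℂ := fun v => RPlus (ℓ v) z [] 0
  have hΦ : Continuous Φ :=
    continuous_RPlus hz hl₀ (fun v e => (hℓ v e).1) (continuous_clampedLength L lam A)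
  set q : (Edge (n + 2) → ℝ) → ℝ := fun v => ‖sol z 1 (Φ v) (ℓ v [])‖ ^ 2
  have hq : Continuous q := by
    have h1 : Continuous fun v => ℓ v [] :=
      (continuous_apply []).comp (continuous_clampedLength L lam A)
    have h2 := (continuous_sol_pair (z := z)).comp (hΦ.prodMk h1)
    exact h2.norm.pow 2
  have hric (v : Edge (n + 2) → ℝ) :
      (∑ j, Φ fun e => v (e ++ [j])) * sol z 1 (Φ v) (ℓ v []) = dsol z 1 (Φ v) (ℓ v []) := by
    have h := (hprop v).2.2.1
    simp only [RiccatiAt, List.append_nil] at h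
    exact h
  have him (v : Edge (n + 2) → ℝ) : z.im * κ ≤ (Φ v).im := (hprop v).1
  have hnorm (v : Edge (n + 2) → ℝ) : ‖Φ v‖ ≤ C := (hprop v).2.1
  have himC (v : Edge (n + 2) → ℝ) : (Φ v).im ≤ C :=
    (le_abs_self _).trans ((Complex.abs_im_le_norm _).trans (hnorm v))
  have hzκ : 0 < z.im * κ := by positivity
  have hqle (v : Edge (n + 2) → ℝ) : q v ≤ S ^ 2 :=
    pow_le_pow_left₀ (norm_nonneg _) (hS _ ((hnorm v).trans hCle) _ (hℓ v [])) 2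
  have hleq (v : Edge (n + 2) → ℝ) : (S ^ 2)⁻¹ ≤ q v := by
    have h1 := congrArg norm (sol_mul_sol_neg hz (hric v))
    rw [norm_mul, norm_one] at h1
    have h2 : ‖-∑ j, Φ fun e => v (e ++ [j])‖ ≤ ((n + 2 : ℕ) : ℝ) * C := by
      rw [norm_neg]
      refine (norm_sum_le_of_le _ fun j _ => hnorm _).trans_eq ?_
      simp
    have h3 := hS _ h2 _ (hℓ v [])
    have h4 : S⁻¹ ≤ ‖sol z 1 (Φ v) (ℓ v [])‖ := by
      rw [inv_le_iff_one_le_mul₀ hS0, ← h1]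
      exact mul_le_mul_of_nonneg_left h3 (norm_nonneg _)
    rw [← inv_pow]
    exact pow_le_pow_left₀ (by positivity) h4 2
  have hW : Measurable fun x e => w e x := measurable_pi_lambda _ hmeas
  have hWj (j : Fin (n + 2)) : Measurable fun x (e : Edge (n + 2)) => w (e ++ [j]) x :=
    measurable_pi_lambda _ fun e => hmeas _
  have hΦim : Measurable fun v => (Φ v).im := (Complex.continuous_im.comp hΦ).measurable
  -- There are countably many edges, so almost surely no length is changed by clamping.
  have hae : ∀ᵐ x ∂P, deformedLength L lam (fun e => w e x) = ℓ fun e => w e x := by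
    filter_upwards [ae_all_iff.2 hM₀] with x hx
    have : (fun e => clamp A (w e x)) = fun e => w e x :=
      funext fun e => clamp_of_abs_le ((hx e).trans (le_abs_self _))
    simp only [ℓ, clampedLength, this]
  refine ⟨fun x => (Φ fun e => w e x).im, fun j x => (Φ fun e => w (e ++ [j]) x).im,
    fun x => q fun e => w e x, min (z.im * κ) (S ^ 2)⁻¹, max C (S ^ 2), ?_, ?_, ?_, ?_⟩
  · exact
      { measX := hΦim.comp hW
        measY := fun j => hΦim.comp (hWj j)
        measQ := hq.measurable.comp hW
        indep := fun i j hij => (indepFun_subtrees hmeas hindep hij).comp hΦim hΦim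
        ident := fun j => (identDistrib_subtree hindep hident j).comp hΦim
        pos := lt_min hzκ (by positivity)
        le_X := fun x => (min_le_left _ _).trans (him _)
        X_le := fun x => (himC _).trans (le_max_left _ _)
        le_Y := fun j x => (min_le_left _ _).trans (him _)
        Y_le := fun j x => (himC _).trans (le_max_left _ _)
        le_Q := fun x => (min_le_right _ _).trans (hleq _)
        Q_le := fun x => (hqle _).trans (le_max_right _ _)
        recursion := fun x => by
          have h := (riccati_bounds hz hκ (hco _ (hℓ (fun e => w e x) []).1)
            (by
              rw [Complex.im_sum]
              exact Finset.sum_nonneg fun j _ => hzκ.le.trans (him _))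
            (hric fun e => w e x)).2.2
          rw [Complex.im_sum] at h
          exact h }
  · filter_upwards [hae] with x hx
    rw [imR, hx]
  · filter_upwards [hae] with x hx
    simp only [modSq, hx, q, Φ, sol, cosSol, sinSol]
    rw [one_mul, mul_comm (RPlus _ _ _ _)]
  · filter_upwards [hae] with x hx
    rw [logRatio, hx, ← norm_div, (hprop _).2.2.2 j, Real.sqrt_sq (norm_nonneg _)]

end

end QuantumTree

end

theorem theorem3p1 {Ω : Type*} [MeasurableSpace Ω] (P : Measure Ω) [IsProbabilityMeasure P]
    (K : ℕ) (hK : 2 ≤ K) (L : ℝ) (hL : 0 < L)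
    (w : QuantumTree.Edge K → Ω → ℝ)
    (hmeas : ∀ e, Measurable (w e))
    (hindep : iIndepFun w P)
    (hident : ∀ e f, IdentDistrib (w e) (w f) P P)
    (hbdd : ∃ M : ℝ, ∀ e, ∀ᵐ x ∂P, |w e x| ≤ M)
    (lam : ℝ) (z : ℂ) (hz : 0 < z.im) (j : Fin K) :
    Integrable (QuantumTree.logRatio w L lam z j) P ∧
    ∀ a : ℝ, 0 < a → a ≤ 1 / 2 →
      ((a = 1 / 2 → 0 ≤ QuantumTree.relWidth P (QuantumTree.imR w L lam z) a) →
        QuantumTree.relWidth P (QuantumTree.imR w L lam z) a ^ 2 ≤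
          8 / a ^ 2 * QuantumTree.lyapunov P w L lam z j) ∧
      ((a = 1 / 2 → 0 ≤ QuantumTree.relWidth P (QuantumTree.modSq w L lam z) a) →
        QuantumTree.relWidth P (QuantumTree.modSq w L lam z) a ^ 2 ≤
          512 * (((K : ℝ) + 1) ^ 2 / a ^ 2) * QuantumTree.lyapunov P w L lam z j) := by
  obtain ⟨n, rfl⟩ := Nat.exists_eq_add_of_le' hK
  obtain ⟨X, Y, Q, m, M, h, hX, hQ, hlog⟩ :=
    QuantumTree.exists_isTreeRecursion hL hmeas hindep hident hbdd lam hz j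
  have hγ : QuantumTree.lyapunov P w L lam z j = QuantumTree.IsTreeRecursion.exponent P n Q := by
    rw [QuantumTree.lyapunov, QuantumTree.IsTreeRecursion.exponent, integral_congr_ae hlog]
  refine ⟨h.integrable_log_ratio.congr hlog.symm, fun a ha ha2 => ?_⟩
  rw [hγ, QuantumTree.relWidth_congr hX, QuantumTree.relWidth_congr hQ]
  have ha1 : a < 1 := by linarith
  refine ⟨fun hδ => h.relWidth_X_sq_le ha ha1 ?_, fun hδ => ?_⟩
  · rcases ha2.eq_or_lt with h1 | h1
    · exact hδ h1
    · exact QuantumTree.relWidth_nonneg h.pos h.le_X h.X_le ha.le h1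
  · have h2 : (((n + 2 : ℕ) : ℝ) + 1) = (n : ℝ) + 3 := by push_cast; ring
    rw [h2]
    refine h.relWidth_Q_sq_le ha ha1 ?_
    rcases ha2.eq_or_lt with h1 | h1
    · exact hδ h1
    · exact QuantumTree.relWidth_nonneg h.pos h.le_Q h.Q_le ha.le h1
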